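/- **Setting.** Let $A$ be a commutative ring with $n$ commuting derivations $\partial_1,\dots,\partial_n$, and let $D=A[d_1,\dots,d_n]$ be the ring of differential operators, generated by $A$ and $d_1,\dots,d_n$ with $d_i a=a\,d_i+\partial_i a$ and $d_id_j=d_jd_i$. A differential module is a left $D$-module; in particular $A$ is one, $d_i$ acting as $\partial_i$. Let $T$ be the free $A$-module of vector fields $\xi=\xi^i d_i$ ($\xi^i\in A$), with bracket $[\xi,\eta]^i=\xi^r\partial_r\eta^i-\eta^s\partial_s\xi^i$, let $T^*=\hom_A(T,A)$ with dual basis $dx^1,\dots,dx^n$, and let $d(\omega_I dx^I)=\partial_i\omega_I\,dx^i\wedge dx^I$ be the exterior derivative. If $M,N$ are left $D$-modules, $\hom_A(M,N)$ and $M\otimes_A N$ are left $D$-modules for $$(d_if)(m)=d_i(f(m))-f(d_im),\qquad d_i(x\otimes y)=d_ix\otimes y+x\otimes d_iy .$$ Let $M$ be any differential module and let $R=\hom_A(M,A)$ be its inverse system; the operators $(d_if)(m)=\partial_i(f(m))-f(d_im)$ on $R$ form the Spencer operator. **Claim.** 1. There is a complex $DR(M)$: $$0\to\wedge^0T^*\otimes_AM\xrightarrow{\nabla}\wedge^1T^*\otimes_AM\xrightarrow{\nabla}\cdots\xrightarrow{\nabla}\wedge^nT^*\otimes_AM\to0,$$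 where $\nabla$ is the additive map with $\nabla(\omega\otimes m)=d\omega\otimes m+\sum_i dx^i\wedge\omega\otimes d_im$. 2. Put $sol_A(M)=\hom_D(M,A)$. There is a complex $$0\to sol_A(M)\to\wedge^0T^*\otimes_AR\xrightarrow{\nabla}\wedge^1T^*\otimes_AR\xrightarrow{\nabla}\cdots\xrightarrow{\nabla}\wedge^nT^*\otimes_AR\to0,\qquad \wedge^0T^*\otimes_AR=R,$$ in which $\nabla(\omega\otimes f)=d\omega\otimes f+\sum_i dx^i\wedge\omega\otimes d_if$ is built from the exterior derivative and the Spencer operator. The map $sol_A(M)\to R$ is the inclusion, and $sol_A(M)$ is the kernel of $\nabla:R\to T^*\otimes_AR$. 3. Consider $D\otimes_AM\otimes_A\wedge^rT$, where $Pa\otimes m=P\otimes am$ and $D$ acts by left multiplication on the first factor, and put $(P\otimes m)\xi=P\xi\otimes m-P\otimes\xi m$ for $\xi\in T$. There are left $D$-linear maps $d^*$ with $$d^*(P\otimes m\otimes\xi_1\wedge\dots\wedge\xi_r)=\sum_i(-1)^{i-1}(P\otimes m)\xi_i\otimes\xi_1\wedge\dots\hat\xi_i\dots\wedge\xi_r+\sum_{i<j}(-1)^{i+j}P\otimes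 m\otimes[\xi_i,\xi_j]\wedge\xi_1\wedge\dots\hat\xi_i\dots\hat\xi_j\dots\wedge\xi_r$$ for $r\ge1$, and together with $P\otimes m\mapsto Pm$ they make the Spencer complex $SP(M)$ a resolution of $M$, that is, the sequence $$0\to D\otimes_AM\otimes_A\wedge^nT\xrightarrow{d^*}\cdots\xrightarrow{d^*}D\otimes_AM\otimes_AT\xrightarrow{d^*}D\otimes_AM\to M\to0$$ of left $D$-modules is exact. 4. There are isomorphisms of complexes of abelian groups $$\hom_D(SP(A)\otimes_AM,A)\;\simeq\;\hom_D(SP(A),R)\;\simeq\;DR(R).$$ The first is the adjunction $F\mapsto(x\mapsto(m\mapsto F(x\otimes m)))$. The inverse of the second sends $\omega\otimes f$ to the $D$-linear map with $1\otimes1\otimes\theta\mapsto\langle\omega,\theta\rangle f$ for $\theta\in\wedge^rT$, where $\langle\alpha_1\wedge\dots\wedge\alpha_r,\xi_1\wedge\dots\wedge\xi_r\rangle=\det(\alpha_i(\xi_j))$. -/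

import Mathlib

open scoped TensorProduct
open Module (Basis)

/-- The data turning a commutative ring `A` into a differential ring: `n` commuting derivations. -/
structure CommutingDerivations (n : ℕ) (A : Type*) [CommRing A] where
  der : Fin n → Derivation ℤ A A
  comm : ∀ i j a, der i (der j a) = der j (der i a)

namespace DiffMod

universe u v w

section Operators

variable {n : ℕ} {A : Type u} [CommRing A] (δ : CommutingDerivations n A)

/-- The relations of the ring `D = A[d₁, …, dₙ]` between the generators `a ∈ A` and `d₁, …, dₙ`:
those of the ring `A`, and `dᵢ a = a dᵢ + ∂ᵢ a`, `dᵢ dⱼ = dⱼ dᵢ`. -/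
inductive OpRel : FreeAlgebra ℤ (A ⊕ Fin n) → FreeAlgebra ℤ (A ⊕ Fin n) → Prop
  | one : OpRel (FreeAlgebra.ι ℤ (Sum.inl 1)) 1
  | add (a b : A) : OpRel (FreeAlgebra.ι ℤ (Sum.inl (a + b)))
      (FreeAlgebra.ι ℤ (Sum.inl a) + FreeAlgebra.ι ℤ (Sum.inl b))
  | mul (a b : A) : OpRel (FreeAlgebra.ι ℤ (Sum.inl (a * b)))
      (FreeAlgebra.ι ℤ (Sum.inl a) * FreeAlgebra.ι ℤ (Sum.inl b))
  | leibniz (i : Fin n) (a : A) :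
      OpRel (FreeAlgebra.ι ℤ (Sum.inr i) * FreeAlgebra.ι ℤ (Sum.inl a))
        (FreeAlgebra.ι ℤ (Sum.inl a) * FreeAlgebra.ι ℤ (Sum.inr i)
          + FreeAlgebra.ι ℤ (Sum.inl (δ.der i a)))
  | comm (i j : Fin n) :
      OpRel (FreeAlgebra.ι ℤ (Sum.inr i) * FreeAlgebra.ι ℤ (Sum.inr j))
        (FreeAlgebra.ι ℤ (Sum.inr j) * FreeAlgebra.ι ℤ (Sum.inr i))

/-- The ring `D = A[d₁, …, dₙ]` of differential operators with coefficients in `A`. -/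
def DiffOp : Type u := RingQuot (OpRel δ)

noncomputable instance : Ring (DiffOp δ) := inferInstanceAs (Ring (RingQuot (OpRel δ)))

namespace DiffOp

/-- The quotient map from the free ring on `A` and `d₁, …, dₙ`. -/
noncomputable def proj : FreeAlgebra ℤ (A ⊕ Fin n) →+* DiffOp δ :=
  RingQuot.mkRingHom (OpRel δ)

theorem proj_rel {x y : FreeAlgebra ℤ (A ⊕ Fin n)} (h : OpRel δ x y) : proj δ x = proj δ y :=
  RingQuot.mkRingHom_rel h

/-- The inclusion `A ⊂ D` of the operators of order zero. -/
noncomputable def ofA : A →+* DiffOp δ :=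
  RingHom.mk' ⟨⟨fun a => proj δ (FreeAlgebra.ι ℤ (Sum.inl a)),
      (proj_rel δ OpRel.one).trans (map_one _)⟩,
    fun a b => (proj_rel δ (OpRel.mul a b)).trans (map_mul _ _ _)⟩
    (fun a b => (proj_rel δ (OpRel.add a b)).trans (map_add _ _ _))

/-- The generator `dᵢ` of `D`. -/
noncomputable def d (i : Fin n) : DiffOp δ := proj δ (FreeAlgebra.ι ℤ (Sum.inr i))

theorem d_mul_ofA (i : Fin n) (a : A) :
    d δ i * ofA δ a = ofA δ a * d δ i + ofA δ (δ.der i a) := by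
  have h := proj_rel δ (OpRel.leibniz i a)
  rw [map_mul, map_add, map_mul] at h
  exact h

theorem d_mul_d (i j : Fin n) : d δ i * d δ j = d δ j * d δ i := by
  have h := proj_rel δ (OpRel.comm i j)
  rw [map_mul, map_mul] at h
  exact h

theorem induction {p : DiffOp δ → Prop} (hA : ∀ a, p (ofA δ a)) (hd : ∀ i, p (d δ i))
    (hadd : ∀ P Q, p P → p Q → p (P + Q)) (hmul : ∀ P Q, p P → p Q → p (P * Q)) (P : DiffOp δ) :
    p P := by
  obtain ⟨x, rfl⟩ := RingQuot.mkRingHom_surjective (OpRel δ) P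
  change p (proj δ x)
  induction x using FreeAlgebra.induction with
  | grade0 r =>
    have : proj δ (algebraMap ℤ _ r) = ofA δ (r : A) := by simp
    rw [this]
    exact hA _
  | grade1 x =>
    rcases x with a | i
    · exact hA a
    · exact hd i
  | mul x y hx hy => rw [map_mul]; exact hmul _ _ hx hy
  | add x y hx hy => rw [map_add]; exact hadd _ _ hx hy

/-- The universal property of `D`. -/
noncomputable def lift {S : Type*} [Ring S] (f : A →+* S) (t : Fin n → S)
    (hl : ∀ i a, t i * f a = f a * t i + f (δ.der i a)) (hc : ∀ i j, t i * t j = t j * t i) :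
    DiffOp δ →+* S :=
  RingQuot.lift ⟨((FreeAlgebra.lift ℤ (Sum.elim f t) : FreeAlgebra ℤ (A ⊕ Fin n) →ₐ[ℤ] S) :
      FreeAlgebra ℤ (A ⊕ Fin n) →+* S), by
    intro x y h
    induction h with
    | one => simp
    | add a b => simp
    | mul a b => simp
    | leibniz i a => simpa using hl i a
    | comm i j => simpa using hc i j⟩

variable {S : Type*} [Ring S] (f : A →+* S) (t : Fin n → S)
    (hl : ∀ i a, t i * f a = f a * t i + f (δ.der i a)) (hc : ∀ i j, t i * t j = t j * t i)

theorem lift_ofA (a : A) : lift δ f t hl hc (ofA δ a) = f a := by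
  change RingQuot.lift _ (RingQuot.mkRingHom (OpRel δ) _) = _
  rw [RingQuot.lift_mkRingHom_apply]
  simp

theorem lift_d (i : Fin n) : lift δ f t hl hc (d δ i) = t i := by
  change RingQuot.lift _ (RingQuot.mkRingHom (OpRel δ) _) = _
  rw [RingQuot.lift_mkRingHom_apply]
  simp

/-- `D` as a left `A`-module. -/
noncomputable instance : Module A (DiffOp δ) := Module.compHom (DiffOp δ) (ofA δ)

theorem smul_eq (a : A) (P : DiffOp δ) : a • P = ofA δ a * P := rfl

/-- The operator `ξ = ξⁱ dᵢ` defined by a vector field. -/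
noncomputable def ofVec (ξ : Fin n → A) : DiffOp δ := ∑ i, ofA δ (ξ i) * d δ i

end DiffOp

theorem ofA_smul {M : Type v} [AddCommGroup M] [Module A M] [Module (DiffOp δ) M]
    [IsScalarTower A (DiffOp δ) M] (a : A) (m : M) : DiffOp.ofA δ a • m = a • m := by
  have : DiffOp.ofA δ a = a • (1 : DiffOp δ) := by rw [DiffOp.smul_eq, mul_one]
  rw [this, smul_assoc, one_smul]

theorem d_smul_smul {M : Type v} [AddCommGroup M] [Module A M] [Module (DiffOp δ) M]
    [IsScalarTower A (DiffOp δ) M] (i : Fin n) (a : A) (m : M) :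
    DiffOp.d δ i • a • m = a • DiffOp.d δ i • m + δ.der i a • m := by
  rw [← ofA_smul δ a m, ← mul_smul, DiffOp.d_mul_ofA, add_smul, mul_smul, ofA_smul, ofA_smul]

theorem d_smul_d_smul {M : Type v} [AddCommGroup M] [Module (DiffOp δ) M]
    (i j : Fin n) (m : M) :
    DiffOp.d δ i • DiffOp.d δ j • m = DiffOp.d δ j • DiffOp.d δ i • m := by
  rw [← mul_smul, DiffOp.d_mul_d, mul_smul]

/-- A left `D`-module structure is the same as an `A`-module structure together with commuting
additive operators `tᵢ` such that `tᵢ (a x) = a tᵢ x + (∂ᵢ a) x`. -/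
@[reducible] noncomputable def moduleOfAction {X : Type v} [AddCommGroup X] [Module A X]
    (t : Fin n → X →+ X) (hl : ∀ i (a : A) x, t i (a • x) = a • t i x + δ.der i a • x)
    (hc : ∀ i j x, t i (t j x) = t j (t i x)) : Module (DiffOp δ) X :=
  Module.compHom X (DiffOp.lift δ (S := AddMonoid.End X) (Module.toAddMonoidEnd A X) t
    (fun i a => AddMonoidHom.ext fun x => hl i a x)
    (fun i j => AddMonoidHom.ext fun x => hc i j x))

section

variable {X : Type v} [AddCommGroup X] [Module A X]
    (t : Fin n → X →+ X) (hl : ∀ i (a : A) x, t i (a • x) = a • t i x + δ.der i a • x)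
    (hc : ∀ i j x, t i (t j x) = t j (t i x))

theorem moduleOfAction_d (i : Fin n) (x : X) :
    letI := moduleOfAction δ t hl hc
    DiffOp.d δ i • x = t i x := by
  exact DFunLike.congr_fun (DiffOp.lift_d δ (S := AddMonoid.End X) _ _ _ _ i) x

theorem moduleOfAction_tower :
    letI := moduleOfAction δ t hl hc
    IsScalarTower A (DiffOp δ) X := by
  let := moduleOfAction δ t hl hc
  refine ⟨fun a P x => ?_⟩
  rw [DiffOp.smul_eq, mul_smul]
  exact DFunLike.congr_fun (DiffOp.lift_ofA δ (S := AddMonoid.End X) _ _ _ _ a) (P • x)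

end

/-- An `A`-linear map between left `D`-modules that commutes with the `dᵢ` is `D`-linear. -/
def dLinear {X : Type v} {Y : Type w} [AddCommGroup X] [Module A X] [Module (DiffOp δ) X]
    [IsScalarTower A (DiffOp δ) X] [AddCommGroup Y] [Module A Y] [Module (DiffOp δ) Y]
    [IsScalarTower A (DiffOp δ) Y] (f : X →ₗ[A] Y)
    (h : ∀ i x, f (DiffOp.d δ i • x) = DiffOp.d δ i • f x) : X →ₗ[DiffOp δ] Y where
  toFun := f
  map_add' := map_add f
  map_smul' P := by
    induction P using DiffOp.induction with
    | hA a => intro x; simp [ofA_smul]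
    | hd i => exact h i
    | hadd P Q hP hQ => intro x; rw [add_smul, map_add, hP, hQ]; simp [add_smul]
    | hmul P Q hP hQ => intro x; rw [mul_smul, hP, hQ]; simp [mul_smul]

end Operators

section Modules

variable {n : ℕ} {A : Type u} [CommRing A] (δ : CommutingDerivations n A)

/-- The operator `∂ᵢ` on `A`. -/
noncomputable def ringAct (i : Fin n) : A →+ A := ((δ.der i : A →ₗ[ℤ] A) : A →+ A)

theorem ringAct_smul (i : Fin n) (a x : A) :
    ringAct δ i (a • x) = a • ringAct δ i x + δ.der i a • x := by
  simp [ringAct, mul_comm]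

/-- `A` as a left `D`-module: `dᵢ` acts as `∂ᵢ`. -/
noncomputable instance : Module (DiffOp δ) A :=
  moduleOfAction δ (ringAct δ) (ringAct_smul δ) (fun i j x => δ.comm i j x)

instance : IsScalarTower A (DiffOp δ) A :=
  moduleOfAction_tower δ (ringAct δ) (ringAct_smul δ) (fun i j x => δ.comm i j x)

theorem d_smul_ring (i : Fin n) (a : A) : DiffOp.d δ i • a = δ.der i a :=
  moduleOfAction_d δ (ringAct δ) (ringAct_smul δ) (fun i j x => δ.comm i j x) i a

variable (A) in
/-- The `A`-module `hom_A(M, N)`, which is a left `D`-module if `M` and `N` are (see below). -/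
def HomA (M : Type v) (N : Type w) [AddCommGroup M] [Module A M] [AddCommGroup N] [Module A N] :
    Type (max v w) := M →ₗ[A] N

variable (A) in
/-- The `A`-module `M ⊗_A N`, which is a left `D`-module if `M` and `N` are (see below). -/
def TensorA (M : Type v) (N : Type w) [AddCommGroup M] [Module A M] [AddCommGroup N]
    [Module A N] : Type (max v w) := M ⊗[A] N

variable (M : Type v) [AddCommGroup M] [Module A M] [Module (DiffOp δ) M]
  [IsScalarTower A (DiffOp δ) M]
  (N : Type w) [AddCommGroup N] [Module A N] [Module (DiffOp δ) N] [IsScalarTower A (DiffOp δ) N]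

noncomputable instance : AddCommGroup (HomA A M N) := inferInstanceAs (AddCommGroup (M →ₗ[A] N))
noncomputable instance : Module A (HomA A M N) := inferInstanceAs (Module A (M →ₗ[A] N))
instance : FunLike (HomA A M N) M N := inferInstanceAs (FunLike (M →ₗ[A] N) M N)

/-- The operator `dᵢ` on `hom_A(M, N)`: `(dᵢ f)(m) = dᵢ (f m) - f (dᵢ m)`. -/
noncomputable def HomA.dAct (i : Fin n) : HomA A M N →+ HomA A M N :=
  AddMonoidHom.mk' (fun f : M →ₗ[A] N =>
    ({ toFun := fun m => DiffOp.d δ i • f m - f (DiffOp.d δ i • m)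
       map_add' := fun x y => by simp only [map_add, smul_add]; abel
       map_smul' := fun a x => by
        simp only [map_smul, d_smul_smul, map_add, RingHom.id_apply, smul_sub]
        abel } : M →ₗ[A] N))
    (fun f g => LinearMap.ext fun m => by
      change DiffOp.d δ i • (f m + g m) - (f (DiffOp.d δ i • m) + g (DiffOp.d δ i • m)) =
        (DiffOp.d δ i • f m - f (DiffOp.d δ i • m)) + (DiffOp.d δ i • g m - g (DiffOp.d δ i • m))
      rw [smul_add]
      abel)

theorem HomA.dAct_smul (i : Fin n) (a : A) (f : HomA A M N) :
    HomA.dAct δ M N i (a • f) = a • HomA.dAct δ M N i f + δ.der i a • f :=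
  LinearMap.ext fun m => by
    change DiffOp.d δ i • a • f m - a • f (DiffOp.d δ i • m) =
      a • (DiffOp.d δ i • f m - f (DiffOp.d δ i • m)) + δ.der i a • f m
    rw [d_smul_smul, smul_sub]
    abel

theorem HomA.dAct_comm (i j : Fin n) (f : HomA A M N) :
    HomA.dAct δ M N i (HomA.dAct δ M N j f) = HomA.dAct δ M N j (HomA.dAct δ M N i f) :=
  LinearMap.ext fun m => by
    change DiffOp.d δ i • (DiffOp.d δ j • f m - f (DiffOp.d δ j • m)) -
        (DiffOp.d δ j • f (DiffOp.d δ i • m) - f (DiffOp.d δ j • DiffOp.d δ i • m)) =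
      DiffOp.d δ j • (DiffOp.d δ i • f m - f (DiffOp.d δ i • m)) -
        (DiffOp.d δ i • f (DiffOp.d δ j • m) - f (DiffOp.d δ i • DiffOp.d δ j • m))
    rw [smul_sub, smul_sub, d_smul_d_smul δ i j (f m), d_smul_d_smul δ i j m]
    abel

/-- `hom_A(M, N)` as a left `D`-module. -/
noncomputable instance : Module (DiffOp δ) (HomA A M N) :=
  moduleOfAction δ (HomA.dAct δ M N) (HomA.dAct_smul δ M N) (HomA.dAct_comm δ M N)

instance : IsScalarTower A (DiffOp δ) (HomA A M N) :=
  moduleOfAction_tower δ (HomA.dAct δ M N) (HomA.dAct_smul δ M N) (HomA.dAct_comm δ M N)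

theorem HomA.d_smul_apply (i : Fin n) (f : HomA A M N) (m : M) :
    (DiffOp.d δ i • f : HomA A M N) m = DiffOp.d δ i • f m - f (DiffOp.d δ i • m) :=
  DFunLike.congr_fun (moduleOfAction_d δ (HomA.dAct δ M N) (HomA.dAct_smul δ M N)
    (HomA.dAct_comm δ M N) i f) m

/-- The inverse system `R = hom_A(M, A)` of `M`, a left `D`-module for the Spencer operator. -/
abbrev InvSystem (A : Type u) [CommRing A] (M : Type v) [AddCommGroup M] [Module A M] :
    Type (max v u) := HomA A M A

/-- The inclusion of `sol_A(M) = hom_D(M, A)` into `R = hom_A(M, A)`. -/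
noncomputable def solToInvSystem (f : M →ₗ[DiffOp δ] A) : InvSystem A M := f.restrictScalars A

noncomputable instance : AddCommGroup (TensorA A M N) := inferInstanceAs (AddCommGroup (M ⊗[A] N))
noncomputable instance : Module A (TensorA A M N) := inferInstanceAs (Module A (M ⊗[A] N))

variable (A) {M N} in
/-- The element `x ⊗ y` of `M ⊗_A N`. -/
def TensorA.tmul (x : M) (y : N) : TensorA A M N := (x ⊗ₜ[A] y : M ⊗[A] N)

/-- The operator `dᵢ` on `M ⊗_A N`: `dᵢ (x ⊗ y) = dᵢ x ⊗ y + x ⊗ dᵢ y`. -/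
noncomputable def TensorA.dAct (i : Fin n) : M ⊗[A] N →+ M ⊗[A] N :=
  TensorProduct.liftAddHom
    (AddMonoidHom.mk' (fun x => AddMonoidHom.mk'
        (fun y => (DiffOp.d δ i • x) ⊗ₜ[A] y + x ⊗ₜ[A] (DiffOp.d δ i • y))
        (fun y z => by simp only [smul_add, TensorProduct.tmul_add]; abel))
      (fun x z => AddMonoidHom.ext fun y => by
        simp only [AddMonoidHom.mk'_apply, AddMonoidHom.add_apply, smul_add,
          TensorProduct.add_tmul]
        abel))
    (fun a x y => by
      simp only [AddMonoidHom.mk'_apply, d_smul_smul, TensorProduct.add_tmul,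
        TensorProduct.tmul_add, TensorProduct.smul_tmul]
      abel)

theorem TensorA.dAct_smul (i : Fin n) (a : A) (x : M ⊗[A] N) :
    TensorA.dAct δ M N i (a • x) = a • TensorA.dAct δ M N i x + δ.der i a • x := by
  induction x using TensorProduct.induction_on with
  | zero => simp
  | tmul x y =>
    rw [TensorProduct.smul_tmul']
    simp only [TensorA.dAct, TensorProduct.liftAddHom_tmul, AddMonoidHom.mk'_apply,
      d_smul_smul, TensorProduct.add_tmul, smul_add, TensorProduct.smul_tmul']
    abel
  | add x y hx hy => rw [smul_add, map_add, hx, hy, map_add, smul_add, smul_add]; abel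

theorem TensorA.dAct_comm (i j : Fin n) (x : M ⊗[A] N) :
    TensorA.dAct δ M N i (TensorA.dAct δ M N j x) =
      TensorA.dAct δ M N j (TensorA.dAct δ M N i x) := by
  induction x using TensorProduct.induction_on with
  | zero => simp
  | tmul x y =>
    simp only [TensorA.dAct, TensorProduct.liftAddHom_tmul, AddMonoidHom.mk'_apply, map_add,
      d_smul_d_smul δ i j x, d_smul_d_smul δ i j y]
    abel
  | add x y hx hy => rw [map_add, map_add, hx, hy, map_add, map_add]

/-- `M ⊗_A N` as a left `D`-module. -/
noncomputable instance : Module (DiffOp δ) (TensorA A M N) :=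
  moduleOfAction δ (X := M ⊗[A] N) (TensorA.dAct δ M N) (TensorA.dAct_smul δ M N)
    (TensorA.dAct_comm δ M N)

instance : IsScalarTower A (DiffOp δ) (TensorA A M N) :=
  moduleOfAction_tower δ (X := M ⊗[A] N) (TensorA.dAct δ M N) (TensorA.dAct_smul δ M N)
    (TensorA.dAct_comm δ M N)

theorem TensorA.d_smul_eq (i : Fin n) (x : TensorA A M N) :
    DiffOp.d δ i • x = TensorA.dAct δ M N i x :=
  moduleOfAction_d δ (X := M ⊗[A] N) (TensorA.dAct δ M N) (TensorA.dAct_smul δ M N)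
    (TensorA.dAct_comm δ M N) i x

theorem TensorA.d_smul_tmul (i : Fin n) (x : M) (y : N) :
    DiffOp.d δ i • TensorA.tmul A x y =
      TensorA.tmul A (DiffOp.d δ i • x) y + TensorA.tmul A x (DiffOp.d δ i • y) :=
  TensorA.d_smul_eq δ M N i _

variable {M}

theorem TensorA.rTensor_dAct {M' : Type*} [AddCommGroup M'] [Module A M'] [Module (DiffOp δ) M']
    [IsScalarTower A (DiffOp δ) M'] (f : M →ₗ[DiffOp δ] M') (i : Fin n) (x : M ⊗[A] N) :
    LinearMap.rTensor N (f.restrictScalars A) (TensorA.dAct δ M N i x) =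
      TensorA.dAct δ M' N i (LinearMap.rTensor N (f.restrictScalars A) x) := by
  induction x using TensorProduct.induction_on with
  | zero => simp
  | tmul x y => simp [TensorA.dAct]
  | add x y hx hy => rw [map_add, map_add, hx, hy, map_add, map_add]

/-- The map `f ⊗ id_N` induced by a `D`-linear map `f`. -/
noncomputable def TensorA.map {M' : Type*} [AddCommGroup M'] [Module A M'] [Module (DiffOp δ) M']
    [IsScalarTower A (DiffOp δ) M'] (f : M →ₗ[DiffOp δ] M') :
    TensorA A M N →ₗ[DiffOp δ] TensorA A M' N :=
  dLinear δ (X := TensorA A M N) (Y := TensorA A M' N)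
    (LinearMap.rTensor N (f.restrictScalars A) : M ⊗[A] N →ₗ[A] M' ⊗[A] N) (fun i x =>
      (congrArg (LinearMap.rTensor N (f.restrictScalars A)) (TensorA.d_smul_eq δ M N i x)).trans
        ((TensorA.rTensor_dAct δ N f i x).trans (TensorA.d_smul_eq δ M' N i _).symm))

end Modules

section Forms

variable {n : ℕ} {A : Type u} [CommRing A]

variable (n A) in
/-- The free module `T` of vector fields `ξ = ξⁱ dᵢ`, given by their components. -/
abbrev Tan : Type u := Fin n → A

variable (n A) in
/-- The module `T* = hom_A(T, A)` of differential forms of degree one. -/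
abbrev Cot : Type u := Module.Dual A (Tan n A)

variable (n A) in
/-- The basis `d₁, …, dₙ` of `T`. -/
noncomputable def frame : Basis (Fin n) A (Tan n A) := Pi.basisFun A (Fin n)

variable (n A) in
/-- The dual basis `dx¹, …, dxⁿ` of `T*`. -/
noncomputable def coframe : Basis (Fin n) A (Cot n A) := (frame n A).dualBasis

/-- The exterior multiplication `ω ↦ x ∧ ω`. -/
noncomputable def wedge {E : Type u} [AddCommGroup E] [Module A E] (s : ℕ) (x : E) :
    ⋀[A]^s E →ₗ[A] ⋀[A]^(s + 1) E :=
  exteriorPower.alternatingMapLinearEquiv ((exteriorPower.ιMulti A (s + 1)).curryLeft x)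

/-- The interior multiplication
`v₀ ∧ … ∧ vₛ ↦ ∑ₖ (-1)ᵏ φ(vₖ) v₀ ∧ … ∧ v̂ₖ ∧ … ∧ vₛ` by a linear form `φ`. -/
noncomputable def contract {E : Type u} [AddCommGroup E] [Module A E] (s : ℕ)
    (φ : Module.Dual A E) : ⋀[A]^(s + 1) E →ₗ[A] ⋀[A]^s E :=
  exteriorPower.alternatingMapLinearEquiv
    (AlternatingMap.alternatizeUncurryFin (φ.smulRight (exteriorPower.ιMulti A s)))

/-- The derivation `∂` applied to the components with respect to a basis. -/
noncomputable def coeffDer {ι : Type*} [Fintype ι] {E : Type*} [AddCommGroup E] [Module A E]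
    (b : Basis ι A E) (D : Derivation ℤ A A) : E →+ E :=
  AddMonoidHom.mk' (fun x => ∑ I, D (b.repr x I) • b I)
    (fun x y => by simp [add_smul, Finset.sum_add_distrib])

theorem coeffDer_smul {ι : Type*} [Fintype ι] {E : Type*} [AddCommGroup E] [Module A E]
    (b : Basis ι A E) (D : Derivation ℤ A A) (a : A) (x : E) :
    coeffDer b D (a • x) = a • coeffDer b D x + D a • x := by
  have h : D a • x = ∑ I, D a • b.repr x I • b I := by rw [← Finset.smul_sum, b.sum_repr]
  rw [h]
  simp only [coeffDer, AddMonoidHom.mk'_apply, map_smul, Finsupp.smul_apply, smul_eq_mul,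
    Derivation.leibniz, add_smul, Finset.sum_add_distrib, Finset.smul_sum, mul_smul]
  exact congrArg _ (Finset.sum_congr rfl fun I _ => smul_comm _ _ _)

variable (δ : CommutingDerivations n A)

/-- `ω_I dx^I ↦ ∂ᵢ ω_I dx^I` on `∧ˢ T*`. -/
noncomputable def formDer (s : ℕ) (i : Fin n) : ⋀[A]^s (Cot n A) →+ ⋀[A]^s (Cot n A) :=
  coeffDer ((coframe n A).exteriorPower s) (δ.der i)

/-- `θ^I d_I ↦ ∂ᵢ θ^I d_I` on `∧ˢ T`. -/
noncomputable def multivecDer (s : ℕ) (i : Fin n) : ⋀[A]^s (Tan n A) →+ ⋀[A]^s (Tan n A) :=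
  coeffDer ((frame n A).exteriorPower s) (δ.der i)

/-- The exterior derivative `d (ω_I dx^I) = ∂ᵢ ω_I dxⁱ ∧ dx^I`. -/
noncomputable def extDer (s : ℕ) : ⋀[A]^s (Cot n A) →+ ⋀[A]^(s + 1) (Cot n A) :=
  AddMonoidHom.mk' (fun ω => ∑ i, wedge s (coframe n A i) (formDer δ s i ω))
    (fun ω ω' => by simp only [map_add, Finset.sum_add_distrib])

theorem extDer_apply (s : ℕ) (ω : ⋀[A]^s (Cot n A)) :
    extDer δ s ω = ∑ i, wedge s (coframe n A i) (formDer δ s i ω) := rfl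

theorem extDer_smul (s : ℕ) (a : A) (ω : ⋀[A]^s (Cot n A)) :
    extDer δ s (a • ω) =
      a • extDer δ s ω + ∑ i, δ.der i a • wedge s (coframe n A i) ω := by
  simp only [extDer_apply, formDer, coeffDer_smul, map_add, map_smul, Finset.sum_add_distrib,
    Finset.smul_sum]

/-- The bracket `[ξ, η]ⁱ = ξʳ ∂ᵣ ηⁱ - ηˢ ∂ₛ ξⁱ` of two vector fields. -/
def bracket (ξ η : Tan n A) : Tan n A :=
  fun i => ∑ r, ξ r * δ.der r (η i) - ∑ s, η s * δ.der s (ξ i)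

end Forms

section DeRham

variable {n : ℕ} {A : Type u} [CommRing A] (δ : CommutingDerivations n A)
  (M : Type v) [AddCommGroup M] [Module A M] [Module (DiffOp δ) M] [IsScalarTower A (DiffOp δ) M]

/-- The operator `∇ : ∧ˢ T* ⊗_A M → ∧ˢ⁺¹ T* ⊗_A M` of the de Rham sequence `DR(M)`,
`∇ (ω ⊗ m) = dω ⊗ m + ∑ᵢ dxⁱ ∧ ω ⊗ dᵢ m`. -/
noncomputable def nabla (s : ℕ) :
    ⋀[A]^s (Cot n A) ⊗[A] M →+ ⋀[A]^(s + 1) (Cot n A) ⊗[A] M :=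
  TensorProduct.liftAddHom
    (AddMonoidHom.mk' (fun ω => AddMonoidHom.mk'
        (fun m => extDer δ s ω ⊗ₜ[A] m +
          ∑ i, wedge s (coframe n A i) ω ⊗ₜ[A] (DiffOp.d δ i • m))
        (fun m m' => by
          simp only [smul_add, TensorProduct.tmul_add, Finset.sum_add_distrib]
          abel))
      (fun ω ω' => AddMonoidHom.ext fun m => by
        simp only [AddMonoidHom.mk'_apply, AddMonoidHom.add_apply, map_add,
          TensorProduct.add_tmul, Finset.sum_add_distrib]
        abel))
    (fun a ω m => by
      simp only [AddMonoidHom.mk'_apply, extDer_smul, d_smul_smul, TensorProduct.add_tmul,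
        TensorProduct.tmul_add, TensorProduct.sum_tmul, map_smul, TensorProduct.smul_tmul,
        Finset.sum_add_distrib]
      abel)

/-- The map `sol_A(M) → ∧⁰ T* ⊗_A R = R`, `f ↦ 1 ⊗ f`, where `R` is the inverse system of `M`. -/
noncomputable def solToDeRham (f : M →ₗ[DiffOp δ] A) :
    ⋀[A]^0 (Cot n A) ⊗[A] InvSystem A M :=
  exteriorPower.ιMulti A 0 (M := Cot n A) ![] ⊗ₜ[A] solToInvSystem δ M f

end DeRham

section Spencer

variable {n : ℕ} {A : Type u} [CommRing A] (δ : CommutingDerivations n A)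

/-- `D` as a left `D`-module and a right `A`-module, the latter written as a module over the
commutative ring `A`: `a • P = P a`. It is the factor `D` in `D ⊗_A M`. -/
def RightDiffOp : Type u := DiffOp δ

namespace RightDiffOp

noncomputable instance : AddCommGroup (RightDiffOp δ) := inferInstanceAs (AddCommGroup (DiffOp δ))

noncomputable instance : Module (DiffOp δ) (RightDiffOp δ) :=
  inferInstanceAs (Module (DiffOp δ) (DiffOp δ))

/-- An operator, as an element of the bimodule `D`. -/
def of (P : DiffOp δ) : RightDiffOp δ := P

variable {δ} in
/-- An element of the bimodule `D`, as an operator. -/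
def op (P : RightDiffOp δ) : DiffOp δ := P

noncomputable instance : Module A (RightDiffOp δ) where
  smul a P := of δ (P.op * DiffOp.ofA δ a)
  one_smul P := show P.op * DiffOp.ofA δ 1 = P.op by rw [map_one, mul_one]
  mul_smul a b P := show P.op * DiffOp.ofA δ (a * b)
      = P.op * DiffOp.ofA δ b * DiffOp.ofA δ a by
    rw [mul_comm a b, map_mul, mul_assoc]
  smul_zero a := zero_mul (DiffOp.ofA δ a)
  smul_add a P Q := add_mul P.op Q.op (DiffOp.ofA δ a)
  add_smul a b P := show P.op * DiffOp.ofA δ (a + b)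
      = P.op * DiffOp.ofA δ a + P.op * DiffOp.ofA δ b by
    rw [map_add, mul_add]
  zero_smul P := show P.op * DiffOp.ofA δ 0 = 0 by rw [map_zero, mul_zero]

theorem smul_of (a : A) (P : DiffOp δ) : a • of δ P = of δ (P * DiffOp.ofA δ a) := rfl

instance : SMulCommClass A (DiffOp δ) (RightDiffOp δ) :=
  ⟨fun a Q P => mul_assoc Q P.op (DiffOp.ofA δ a)⟩

/-- `P ↦ P dᵢ`, an additive map of `D`. -/
noncomputable def mulD (i : Fin n) : RightDiffOp δ →+ RightDiffOp δ :=
  AddMonoidHom.mulRight (DiffOp.d δ i)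

theorem mulD_smul (i : Fin n) (a : A) (P : RightDiffOp δ) :
    mulD δ i (a • P) = a • mulD δ i P - δ.der i a • P := by
  change P.op * DiffOp.ofA δ a * DiffOp.d δ i =
    P.op * DiffOp.d δ i * DiffOp.ofA δ a - P.op * DiffOp.ofA δ (δ.der i a)
  rw [mul_assoc, mul_assoc, DiffOp.d_mul_ofA, mul_add]
  exact (add_sub_cancel_right _ _).symm

end RightDiffOp

variable (M : Type v) [AddCommGroup M] [Module A M] [Module (DiffOp δ) M]
  [IsScalarTower A (DiffOp δ) M]

/-- The left `D`-module `D ⊗_A M`, where `P a ⊗ m = P ⊗ a m` and `Q (P ⊗ m) = Q P ⊗ m`. -/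
abbrev Induced : Type (max u v) := RightDiffOp δ ⊗[A] M

/-- The right action `(P ⊗ m) dᵢ = P dᵢ ⊗ m - P ⊗ dᵢ m` of `dᵢ` on `D ⊗_A M`. -/
noncomputable def rightAct (i : Fin n) : Induced δ M →+ Induced δ M :=
  TensorProduct.liftAddHom
    (AddMonoidHom.mk' (fun P => AddMonoidHom.mk'
        (fun m => RightDiffOp.mulD δ i P ⊗ₜ[A] m - P ⊗ₜ[A] (DiffOp.d δ i • m))
        (fun m m' => by simp only [smul_add, TensorProduct.tmul_add]; abel))
      (fun P P' => AddMonoidHom.ext fun m => by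
        simp only [AddMonoidHom.mk'_apply, AddMonoidHom.add_apply, map_add,
          TensorProduct.add_tmul]
        abel))
    (fun a P m => by
      simp only [AddMonoidHom.mk'_apply, RightDiffOp.mulD_smul, d_smul_smul,
        TensorProduct.sub_tmul, TensorProduct.tmul_add, TensorProduct.smul_tmul]
      abel)

theorem rightAct_tmul (i : Fin n) (P : DiffOp δ) (m : M) :
    rightAct δ M i (RightDiffOp.of δ P ⊗ₜ[A] m) =
      RightDiffOp.of δ (P * DiffOp.d δ i) ⊗ₜ[A] m
        - RightDiffOp.of δ P ⊗ₜ[A] (DiffOp.d δ i • m) := rfl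

theorem rightAct_smul (i : Fin n) (a : A) (x : Induced δ M) :
    rightAct δ M i (a • x) = a • rightAct δ M i x - δ.der i a • x := by
  induction x using TensorProduct.induction_on with
  | zero => simp
  | tmul P m =>
    rw [TensorProduct.smul_tmul']
    simp only [rightAct, TensorProduct.liftAddHom_tmul, AddMonoidHom.mk'_apply,
      RightDiffOp.mulD_smul, TensorProduct.sub_tmul, smul_sub, TensorProduct.smul_tmul']
    abel
  | add x y hx hy => rw [smul_add, map_add, hx, hy, map_add, smul_add, smul_add]; abel

theorem rightAct_left (i : Fin n) (Q : DiffOp δ) (x : Induced δ M) :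
    rightAct δ M i (Q • x) = Q • rightAct δ M i x := by
  induction x using TensorProduct.induction_on with
  | zero => simp
  | tmul P m =>
    rw [TensorProduct.smul_tmul', show Q • P = RightDiffOp.of δ (Q * P.op) from rfl,
      rightAct_tmul, show P = RightDiffOp.of δ P.op from rfl, rightAct_tmul, smul_sub,
      TensorProduct.smul_tmul', TensorProduct.smul_tmul', mul_assoc]
    rfl
  | add x y hx hy => rw [smul_add, map_add, hx, hy, map_add, smul_add]

/-- The term `D ⊗_A M ⊗_A ∧ʳ T` of the Spencer complex `SP(M)`. -/
def Spencer (r : ℕ) : Type (max u v) := Induced δ M ⊗[A] ⋀[A]^r (Tan n A)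

noncomputable instance (r : ℕ) : AddCommGroup (Spencer δ M r) :=
  inferInstanceAs (AddCommGroup (Induced δ M ⊗[A] ⋀[A]^r (Tan n A)))

/-- The left `D`-module structure `Q (P ⊗ m ⊗ θ) = Q P ⊗ m ⊗ θ`. -/
noncomputable instance (r : ℕ) : Module (DiffOp δ) (Spencer δ M r) :=
  inferInstanceAs (Module (DiffOp δ) (Induced δ M ⊗[A] ⋀[A]^r (Tan n A)))

/-- The `A`-module underlying the left `D`-module: `a (P ⊗ m ⊗ θ) = a P ⊗ m ⊗ θ`. -/
noncomputable instance (r : ℕ) : Module A (Spencer δ M r) :=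
  Module.compHom _ (DiffOp.ofA δ)

instance (r : ℕ) : IsScalarTower A (DiffOp δ) (Spencer δ M r) :=
  ⟨fun a P x => mul_smul (DiffOp.ofA δ a) P x⟩

variable {M}

/-- The element `x ⊗ θ` of `(D ⊗_A M) ⊗_A ∧ʳ T`. -/
noncomputable def Spencer.tmul {r : ℕ} (x : Induced δ M) (θ : ⋀[A]^r (Tan n A)) : Spencer δ M r :=
  (x ⊗ₜ[A] θ : Induced δ M ⊗[A] ⋀[A]^r (Tan n A))

/-- The element `P ⊗ m ⊗ θ` of `D ⊗_A M ⊗_A ∧ʳ T`. -/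
noncomputable def Spencer.mk {r : ℕ} (P : DiffOp δ) (m : M) (θ : ⋀[A]^r (Tan n A)) : Spencer δ M r :=
  Spencer.tmul δ (RightDiffOp.of δ P ⊗ₜ[A] m) θ

variable (M)

/-- The additive map underlying the Spencer differential:
`x ⊗ θ ↦ ∑ₖ (x dₖ ⊗ i(dxᵏ) θ - x ⊗ i(dxᵏ) (∂ₖ θ))` for `x ∈ D ⊗_A M`, where `∂ₖ` acts on the
components of `θ`. On `θ = d_{i₀} ∧ … ∧ d_{iᵣ}` it is
`∑ₖ (-1)ᵏ x d_{iₖ} ⊗ d_{i₀} ∧ … ∧ d̂_{iₖ} ∧ … ∧ d_{iᵣ}`. -/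
noncomputable def spencerAdd (r : ℕ) :
    Induced δ M ⊗[A] ⋀[A]^(r + 1) (Tan n A) →+ Induced δ M ⊗[A] ⋀[A]^r (Tan n A) :=
  TensorProduct.liftAddHom
    (AddMonoidHom.mk' (fun x => AddMonoidHom.mk'
        (fun θ => ∑ k, (rightAct δ M k x ⊗ₜ[A] contract r (coframe n A k) θ
          - x ⊗ₜ[A] contract r (coframe n A k) (multivecDer δ (r + 1) k θ)))
        (fun θ θ' => by
          rw [← Finset.sum_add_distrib]
          refine Finset.sum_congr rfl fun k _ => ?_
          simp only [map_add, TensorProduct.tmul_add]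
          abel))
      (fun x x' => AddMonoidHom.ext fun θ => by
        simp only [AddMonoidHom.mk'_apply, AddMonoidHom.add_apply]
        rw [← Finset.sum_add_distrib]
        refine Finset.sum_congr rfl fun k _ => ?_
        simp only [map_add, TensorProduct.add_tmul]
        abel))
    (fun a x θ => by
      simp only [AddMonoidHom.mk'_apply]
      refine Finset.sum_congr rfl fun k _ => ?_
      simp only [rightAct_smul, multivecDer, coeffDer_smul, map_add, map_smul,
        TensorProduct.sub_tmul, TensorProduct.tmul_add, TensorProduct.smul_tmul]
      abel)

theorem spencerAdd_left (r : ℕ) (Q : DiffOp δ) (x : Induced δ M ⊗[A] ⋀[A]^(r + 1) (Tan n A)) :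
    spencerAdd δ M r (Q • x) = Q • spencerAdd δ M r x := by
  induction x using TensorProduct.induction_on with
  | zero => rw [smul_zero, map_zero, smul_zero]
  | tmul x θ =>
    rw [TensorProduct.smul_tmul']
    simp only [spencerAdd, TensorProduct.liftAddHom_tmul, AddMonoidHom.mk'_apply,
      rightAct_left, Finset.smul_sum, smul_sub, TensorProduct.smul_tmul']
  | add x y hx hy => rw [smul_add, map_add, hx, hy, map_add, smul_add]

/-- The differential `d* : D ⊗_A M ⊗_A ∧ʳ⁺¹ T → D ⊗_A M ⊗_A ∧ʳ T` of the Spencer complex. -/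
noncomputable def spencerD (r : ℕ) : Spencer δ M (r + 1) →ₗ[DiffOp δ] Spencer δ M r where
  toFun := spencerAdd δ M r
  map_add' := map_add (spencerAdd δ M r)
  map_smul' := spencerAdd_left δ M r

/-- The additive map underlying the augmentation `P ⊗ m ↦ P m`. -/
noncomputable def augAdd : Induced δ M →+ M :=
  TensorProduct.liftAddHom
    (AddMonoidHom.mk' (fun P => AddMonoidHom.mk' (fun m => P.op • m)
        (fun m m' => smul_add P.op m m'))
      (fun P P' => AddMonoidHom.ext fun m => add_smul P.op P'.op m))
    (fun a P m => by
      change (P.op * DiffOp.ofA δ a) • m = P.op • a • m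
      rw [mul_smul, ofA_smul])

theorem augAdd_left (Q : DiffOp δ) (x : Induced δ M) :
    augAdd δ M (Q • x) = Q • augAdd δ M x := by
  induction x using TensorProduct.induction_on with
  | zero => simp
  | tmul P m => exact mul_smul Q P.op m
  | add x y hx hy => rw [smul_add, map_add, hx, hy, map_add, smul_add]

/-- The isomorphism `D ⊗_A M ⊗_A ∧⁰ T = D ⊗_A M`. -/
noncomputable def spencerZero : Induced δ M ⊗[A] ⋀[A]^0 (Tan n A) →ₗ[A] Induced δ M :=
  (TensorProduct.rid A (Induced δ M)).toLinearMap ∘ₗ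
    LinearMap.lTensor (Induced δ M) (exteriorPower.zeroEquiv (R := A) (M := Tan n A)).toLinearMap

set_option linter.unusedSectionVars false in
theorem spencerZero_left (Q : DiffOp δ) (x : Induced δ M ⊗[A] ⋀[A]^0 (Tan n A)) :
    spencerZero δ M (Q • x) = Q • spencerZero δ M x := by
  induction x using TensorProduct.induction_on with
  | zero => simp
  | tmul x θ =>
    rw [TensorProduct.smul_tmul']
    simp only [spencerZero, LinearMap.comp_apply, LinearMap.lTensor_tmul,
      LinearEquiv.coe_coe, TensorProduct.rid_tmul]
    exact smul_comm _ _ _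
  | add x y hx hy => rw [smul_add, map_add, hx, hy, map_add, smul_add]

/-- The augmentation `D ⊗_A M ⊗_A ∧⁰ T = D ⊗_A M → M`, `P ⊗ m ↦ P m`. -/
noncomputable def spencerAug : Spencer δ M 0 →ₗ[DiffOp δ] M where
  toFun x := augAdd δ M (spencerZero δ M x)
  map_add' x y := (congrArg (augAdd δ M) (map_add (spencerZero δ M) x y)).trans
    (map_add (augAdd δ M) _ _)
  map_smul' Q x := (congrArg (augAdd δ M) (spencerZero_left δ M Q x)).trans
    (augAdd_left δ M Q _)

end Spencer

end DiffMod

open DiffMod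

/-! All operators are tested on exterior products with constant coefficients. The integral
combinations of products of basis vectors, `constMul`, are killed by every `∂ᵢ`, are stable under
`dxⁱ ∧` and under contraction with `dxᵏ`, and generate the exterior power over `A`. On such elements
`∇` becomes `∑ᵢ (dxⁱ ∧) ⊗ dᵢ` and `d*` becomes `∑ₖ (· dₖ) ⊗ i(dxᵏ)`. In both cases commuting
operators are paired with anticommuting ones, so the square is zero (`nabla_nabla`,
`spencerAdd_spencerAdd`).

In degree zero, `∇ f = 0` says `dᵢ f = 0` for all `i`, that is, `f` commutes with the `dᵢ`. Being
`A`-linear, such an `f` is `D`-linear, hence a solution.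

For the resolution, `SP(M)` is seen as the Koszul complex of the commuting operators `x ↦ x dₖ` on
`D ⊗_A M`. Let `dᵢ` act on polynomials with coefficients in `M` by `Xᵢ + dᵢ`. Then `P ⊗ m ↦ P m`
turns `x ↦ x dₖ` into multiplication by `Xₖ`, and it has the left inverse `m X^α ↦ (1 ⊗ m) d^α`
(`ofPoly_toPoly`). Division by `Xₖ` therefore yields a left inverse `S` of `x ↦ x dₖ` that commutes
with the other `x ↦ x dⱼ`. The homotopy `S ⊗ (dₖ ∧)` pushes a cycle, modulo boundaries, into the
span of the products without `dₖ`; once all `k` are used up nothing is left in positive degree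
(`exists_spencerAdd_eq`). In degree zero, `P ⊗ m` is congruent to `1 ⊗ P m` modulo the `x dₖ`.

The bracket formula for `d*` comes from evaluating it on arbitrary vector fields: the derivatives of
the components of `ξⱼ` along `ξᵢ` and of `ξᵢ` along `ξⱼ` enter with opposite signs and combine to
`[ξᵢ, ξⱼ]`.

For the last claim, `D ⊗_A A ⊗_A ∧ʳ T` is induced from `∧ʳ T`, so its `D`-linear maps to `N` are the
`A`-linear maps `∧ʳ T → N`, which form `∧ʳ T* ⊗ N` because `T` is free of finite rank. The
differentials match since `dxᵏ ∧` is adjoint to contraction with `dxᵏ` (`pairingDual_wedge`). -/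

namespace DiffMod

universe u v w

set_option linter.unusedSectionVars false

/-! ### Exterior and interior multiplication -/

section Exterior

variable {A : Type u} [CommRing A] {E : Type u} [AddCommGroup E] [Module A E]

theorem wedge_ιMulti (s : ℕ) (v : E) (w : Fin s → E) :
    wedge (A := A) s v (exteriorPower.ιMulti A s w) =
      exteriorPower.ιMulti A (s + 1) (Matrix.vecCons v w) := by
  simp [wedge]

theorem contract_ιMulti (s : ℕ) (φ : Module.Dual A E) (w : Fin (s + 1) → E) :
    contract s φ (exteriorPower.ιMulti A (s + 1) w) =
      ∑ j : Fin (s + 1), (-1 : ℤ) ^ (j : ℕ) • φ (w j) •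
        exteriorPower.ιMulti A s (j.removeNth w) := by
  simp [contract, AlternatingMap.alternatizeUncurryFin_apply]

theorem exteriorPower_induction {s : ℕ} {p : ⋀[A]^s E → Prop}
    (smul_ι : ∀ (a : A) w, p (a • exteriorPower.ιMulti A s w))
    (add : ∀ x y, p x → p y → p (x + y)) (x : ⋀[A]^s E) : p x := by
  have hx : x ∈ Submodule.span A (Set.range (exteriorPower.ιMulti A s (M := E))) := by
    rw [exteriorPower.ιMulti_span]; trivial
  induction hx using Submodule.closure_induction with
  | zero => simpa using smul_ι 0 0
  | add x y _ _ hx hy => exact add x y hx hy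
  | smul_mem a x hx => obtain ⟨w, rfl⟩ := hx; exact smul_ι a w

theorem wedge_induction {s : ℕ} {p : ⋀[A]^(s + 1) E → Prop}
    (wedge : ∀ v (θ : ⋀[A]^s E), p (wedge s v θ))
    (add : ∀ x y, p x → p y → p (x + y)) (x : ⋀[A]^(s + 1) E) : p x := by
  induction x using exteriorPower_induction with
  | smul_ι a w =>
    have := wedge (w 0) (a • exteriorPower.ιMulti A s (Fin.tail w))
    rwa [map_smul, wedge_ιMulti, Matrix.vecCons, Fin.cons_self_tail] at this
  | add x y hx hy => exact add x y hx hy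

theorem wedge_add_left (s : ℕ) (v w : E) (θ : ⋀[A]^s E) :
    wedge s (v + w) θ = wedge s v θ + wedge s w θ := by
  simp [wedge]

theorem wedge_smul_left (s : ℕ) (a : A) (v : E) (θ : ⋀[A]^s E) :
    wedge s (a • v) θ = a • wedge s v θ := by
  simp [wedge]

/-- The exterior multiplication, linear in both arguments. -/
noncomputable def wedgeLin (A : Type u) [CommRing A] {E : Type u} [AddCommGroup E] [Module A E]
    (s : ℕ) : E →ₗ[A] ⋀[A]^s E →ₗ[A] ⋀[A]^(s + 1) E where
  toFun := wedge s
  map_add' v w := LinearMap.ext (wedge_add_left s v w)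
  map_smul' a v := LinearMap.ext (wedge_smul_left s a v)

theorem wedge_wedge_self (s : ℕ) (v : E) (θ : ⋀[A]^s E) :
    wedge (s + 1) v (wedge s v θ) = 0 := by
  induction θ using exteriorPower_induction with
  | smul_ι a w =>
    rw [map_smul, map_smul, wedge_ιMulti, wedge_ιMulti,
      AlternatingMap.map_eq_zero_of_eq _ _ (i := 0) (j := 1) (by simp) (by simp), smul_zero]
  | add x y hx hy => rw [map_add, map_add, hx, hy, add_zero]

/-- Polarization of `wedge_wedge_self` at `v + w`. -/
theorem wedge_wedge_comm (s : ℕ) (v w : E) (θ : ⋀[A]^s E) :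
    wedge (s + 1) v (wedge s w θ) = -wedge (s + 1) w (wedge s v θ) := by
  have h := wedge_wedge_self s (v + w) θ
  simp only [wedge_add_left, map_add, wedge_wedge_self, zero_add, add_zero] at h
  exact eq_neg_of_add_eq_zero_right h

theorem contract_wedge_zero (φ : Module.Dual A E) (v : E) (θ : ⋀[A]^0 E) :
    contract 0 φ (wedge 0 v θ) = φ v • θ := by
  induction θ using exteriorPower_induction with
  | smul_ι a w =>
    rw [map_smul, map_smul, wedge_ιMulti, contract_ιMulti, smul_comm]
    have h : Fin.removeNth 0 (Matrix.vecCons v w) = w := Subsingleton.elim _ _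
    rw [Fin.sum_univ_succ, Fin.sum_univ_zero, add_zero, h, Fin.val_zero, pow_zero, one_zsmul,
      Matrix.cons_val_zero]
  | add x y hx hy => rw [map_add, map_add, hx, hy, smul_add]

/-- Contraction is an antiderivation: in the alternating sum, the term `j = 0` removes `v`, and the
others keep `v` in front while their sign is shifted by one. In degree zero the second term does not
exist, whence the separate `contract_wedge_zero`. -/
theorem contract_wedge (s : ℕ) (φ : Module.Dual A E) (v : E) (θ : ⋀[A]^(s + 1) E) :
    contract (s + 1) φ (wedge (s + 1) v θ) = φ v • θ - wedge s v (contract s φ θ) := by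
  induction θ using exteriorPower_induction with
  | smul_ι a w =>
    have h : contract (s + 1) φ (wedge (s + 1) v (exteriorPower.ιMulti A (s + 1) w)) =
        φ v • exteriorPower.ιMulti A (s + 1) w
          - wedge s v (contract s φ (exteriorPower.ιMulti A (s + 1) w)) := by
      rw [wedge_ιMulti, contract_ιMulti, contract_ιMulti, Fin.sum_univ_succ, map_sum,
        sub_eq_add_neg, ← Finset.sum_neg_distrib]
      congr 1
      · simp [Matrix.vecCons]
      · refine Finset.sum_congr rfl fun j _ => ?_
        rw [map_zsmul, map_smul, wedge_ιMulti, Fin.val_succ, pow_succ]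
        simp only [mul_neg, mul_one, neg_smul, Matrix.cons_val_succ]
        congr 4
        ext i
        refine Fin.cases ?_ (fun i => ?_) i <;> simp [Fin.removeNth, Matrix.vecCons]
    simp only [map_smul, h, smul_sub, smul_comm a (φ v)]
  | add x y hx hy => simp only [map_add, hx, hy, smul_add]; abel

/-- Induction on the degree with the antiderivation rule: on `v ∧ θ` the two terms `φ(v) i(φ) θ`
cancel, and what remains contains `i(φ)² θ` in lower degree. -/
theorem contract_contract_self (s : ℕ) (φ : Module.Dual A E) (θ : ⋀[A]^(s + 2) E) :
    contract s φ (contract (s + 1) φ θ) = 0 := by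
  induction s with
  | zero =>
    induction θ using wedge_induction with
    | wedge v θ => rw [contract_wedge, map_sub, contract_wedge_zero, map_smul, sub_self]
    | add x y hx hy => rw [map_add, map_add, hx, hy, add_zero]
  | succ s ih =>
    induction θ using wedge_induction with
    | wedge v θ =>
      rw [contract_wedge, map_sub, contract_wedge, map_smul, ih, map_zero, sub_zero, sub_self]
    | add x y hx hy => rw [map_add, map_add, hx, hy, add_zero]

theorem contract_add_left (s : ℕ) (φ ψ : Module.Dual A E) (θ : ⋀[A]^(s + 1) E) :
    contract s (φ + ψ) θ = contract s φ θ + contract s ψ θ := by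
  induction θ using exteriorPower_induction with
  | smul_ι a w =>
    simp only [map_smul, contract_ιMulti, LinearMap.add_apply, add_smul, smul_add,
      Finset.sum_add_distrib]
  | add x y hx hy => simp only [map_add, hx, hy]; abel

theorem contract_contract_comm (s : ℕ) (φ ψ : Module.Dual A E) (θ : ⋀[A]^(s + 2) E) :
    contract s φ (contract (s + 1) ψ θ) = -contract s ψ (contract (s + 1) φ θ) := by
  have h := contract_contract_self s (φ + ψ) θ
  simp only [contract_add_left, map_add, contract_contract_self, zero_add, add_zero] at h
  exact eq_neg_of_add_eq_zero_right h

/-- A double sum of antisymmetric terms with zero diagonal vanishes. -/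
theorem sum_sum_eq_zero_of_antisymm {ι X : Type*} [Fintype ι] [AddCommGroup X] (F : ι → ι → X)
    (hd : ∀ i, F i i = 0) (ha : ∀ i j, F i j = -F j i) : ∑ i, ∑ j, F i j = 0 := by
  classical
  rw [← Fintype.sum_prod_type']
  refine Finset.sum_involution (fun p _ => p.swap) (fun p _ => ?_) (fun p _ hp h => hp ?_)
    (fun _ _ => Finset.mem_univ _) (fun _ _ => rfl)
  · simp [ha p.2 p.1]
  · have : p.2 = p.1 := congrArg Prod.fst h
    rw [this, hd]

/-- The basis of the exterior power is indexed by the `s`-element subsets, of which there are none.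
-/
theorem subsingleton_exteriorPower {ι : Type*} [LinearOrder ι] [Fintype ι] (b : Basis ι A E)
    {s : ℕ} (h : Fintype.card ι < s) : Subsingleton (⋀[A]^s E) := by
  have : IsEmpty (Set.powersetCard ι s) :=
    ⟨fun I => absurd (Finset.card_le_univ I.1) (by rw [I.2]; omega)⟩
  exact (b.exteriorPower s).repr.toEquiv.subsingleton

end Exterior

/-! ### Elements with constant coefficients -/

section Constant

variable {A : Type u} [CommRing A] {E : Type u} [AddCommGroup E] [Module A E]
  {ι : Type*} [LinearOrder ι] [Fintype ι] (b : Basis ι A E)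

/-- The integral combinations of the exterior products of basis vectors. -/
def constMul (s : ℕ) : AddSubgroup (⋀[A]^s E) :=
  AddSubgroup.closure (Set.range fun f : Fin s → ι => exteriorPower.ιMulti A s (b ∘ f))

variable {b}

theorem ιMulti_mem_constMul {s : ℕ} (f : Fin s → ι) :
    exteriorPower.ιMulti A s (b ∘ f) ∈ constMul b s :=
  AddSubgroup.subset_closure ⟨f, rfl⟩

theorem basis_mem_constMul {s : ℕ} (I) : b.exteriorPower s I ∈ constMul b s := by
  rw [exteriorPower.basis_apply]
  exact ιMulti_mem_constMul _

/-- Integrality of the coordinates is what makes derivations, and later arbitrary additive maps,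
behave well on these elements. -/
theorem repr_constMul {s : ℕ} {θ : ⋀[A]^s E} (h : θ ∈ constMul b s) (I) :
    ∃ c : ℤ, (b.exteriorPower s).repr θ I = c := by
  induction h using AddSubgroup.closure_induction with
  | mem x hx =>
    obtain ⟨f, rfl⟩ := hx
    -- The coordinate is a minor of the matrix of coordinates of the factors `b (f j)`, whose
    -- entries are 0 and 1.
    refine ⟨Matrix.det (Matrix.of fun i j => if Set.powersetCard.ofFinEmbEquiv.symm I j = f i
      then 1 else 0), ?_⟩
    rw [exteriorPower.basis_repr_apply, exteriorPower.ιMultiDual_apply_ιMulti, Int.cast_det]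
    congr 1
    ext i j
    simp [Finsupp.single_apply, eq_comm]
  | zero => exact ⟨0, by simp⟩
  | add x y _ _ hx hy =>
    obtain ⟨c, hc⟩ := hx
    obtain ⟨e, he⟩ := hy
    exact ⟨c + e, by simp [hc, he]⟩
  | neg x _ hx =>
    obtain ⟨c, hc⟩ := hx
    exact ⟨-c, by simp [hc]⟩

theorem wedge_mem_constMul {s : ℕ} (k : ι) {θ : ⋀[A]^s E} (h : θ ∈ constMul b s) :
    wedge s (b k) θ ∈ constMul b (s + 1) := by
  induction h using AddSubgroup.closure_induction with
  | mem x hx =>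
    obtain ⟨f, rfl⟩ := hx
    simp only
    rw [wedge_ιMulti]
    convert! ιMulti_mem_constMul (Matrix.vecCons k f)
    ext i
    refine Fin.cases ?_ (fun i => ?_) i <;> simp
  | zero => rw [map_zero]; exact zero_mem _
  | add x y _ _ hx hy => rw [map_add]; exact add_mem hx hy
  | neg x _ hx => rw [map_neg]; exact neg_mem hx

theorem contract_mem_constMul {s : ℕ} {φ : Module.Dual A E} (hφ : ∀ i, ∃ c : ℤ, φ (b i) = c)
    {θ : ⋀[A]^(s + 1) E} (h : θ ∈ constMul b (s + 1)) : contract s φ θ ∈ constMul b s := by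
  induction h using AddSubgroup.closure_induction with
  | mem x hx =>
    obtain ⟨f, rfl⟩ := hx
    simp only
    rw [contract_ιMulti]
    refine sum_mem fun j _ => zsmul_mem ?_ _
    obtain ⟨c, hc⟩ := hφ (f j)
    rw [Function.comp_apply, hc]
    have h := zsmul_mem (ιMulti_mem_constMul (A := A) (b := b) (j.removeNth f)) c
    rwa [← Int.cast_smul_eq_zsmul A] at h
  | zero => rw [map_zero]; exact zero_mem _
  | add x y _ _ hx hy => rw [map_add]; exact add_mem hx hy
  | neg x _ hx => rw [map_neg]; exact neg_mem hx

/-- Basis elements are constant, so every element is a sum of `A`-multiples of constant ones.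
Identities between additive operators thus need checking on `a • θ` only. -/
theorem constMul_induction {s : ℕ} {p : ⋀[A]^s E → Prop}
    (smul_const : ∀ (a : A), ∀ θ ∈ constMul b s, p (a • θ))
    (add : ∀ x y, p x → p y → p (x + y)) (x : ⋀[A]^s E) : p x := by
  rw [← (b.exteriorPower s).sum_repr x]
  refine Finset.sum_induction _ p add ?_ fun I _ => smul_const _ _ (basis_mem_constMul I)
  simpa using smul_const 0 0 (zero_mem _)

theorem coeffDer_constMul (D : Derivation ℤ A A) {s : ℕ} {θ : ⋀[A]^s E}
    (h : θ ∈ constMul b s) : coeffDer (b.exteriorPower s) D θ = 0 := by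
  refine Finset.sum_eq_zero fun I _ => ?_
  obtain ⟨c, hc⟩ := repr_constMul h I
  rw [hc, D.map_intCast, zero_smul]

theorem coeffDer_smul_constMul (D : Derivation ℤ A A) {s : ℕ} (a : A) {θ : ⋀[A]^s E}
    (h : θ ∈ constMul b s) : coeffDer (b.exteriorPower s) D (a • θ) = D a • θ := by
  rw [coeffDer_smul, coeffDer_constMul D h, smul_zero, zero_add]

/-- Leibniz rule. Wedging with a basis vector preserves constancy, so it commutes with `D`; a
general `v` is expanded in the basis, and its coefficients produce the other term. -/
theorem coeffDer_wedge (D : Derivation ℤ A A) {s : ℕ} (v : E) (θ : ⋀[A]^s E) :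
    coeffDer (b.exteriorPower (s + 1)) D (wedge s v θ) =
      wedge s (coeffDer b D v) θ + wedge s v (coeffDer (b.exteriorPower s) D θ) := by
  have hb : ∀ k (θ : ⋀[A]^s E), coeffDer (b.exteriorPower (s + 1)) D (wedge s (b k) θ) =
      wedge s (b k) (coeffDer (b.exteriorPower s) D θ) := fun k θ => by
    induction θ using constMul_induction (b := b) with
    | smul_const a θ h =>
      rw [map_smul, coeffDer_smul_constMul D a (wedge_mem_constMul k h),
        coeffDer_smul_constMul D a h, map_smul]
    | add x y hx hy => simp only [map_add, hx, hy]
  have hw : ∀ (c : ι → A) (θ : ⋀[A]^s E),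
      wedge s (∑ k, c k • b k) θ = ∑ k, c k • wedge s (b k) θ := fun c θ => by
    change wedgeLin A s _ θ = ∑ k, c k • wedgeLin A s (b k) θ
    simp only [map_sum, map_smul, LinearMap.sum_apply, LinearMap.smul_apply]
  have hv : v = ∑ k, b.repr v k • b k := (b.sum_repr v).symm
  have hd : coeffDer b D v = ∑ k, D (b.repr v k) • b k := rfl
  rw [hd, hw]
  have hl : wedge (A := A) s v = wedge s (∑ k, b.repr v k • b k) := by rw [← hv]
  rw [hl]
  simp only [hw, map_sum, coeffDer_smul, hb, Finset.sum_add_distrib]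
  exact add_comm (G := ⋀[A]^(s + 1) E) _ _

/-- Integral values on the basis mean that `φ` has constant coefficients, so no derivative of `φ`
appears. -/
theorem coeffDer_contract (D : Derivation ℤ A A) {s : ℕ} {φ : Module.Dual A E}
    (hφ : ∀ i, ∃ c : ℤ, φ (b i) = c) (θ : ⋀[A]^(s + 1) E) :
    coeffDer (b.exteriorPower s) D (contract s φ θ) =
      contract s φ (coeffDer (b.exteriorPower (s + 1)) D θ) := by
  induction θ using constMul_induction (b := b) with
  | smul_const a θ h =>
    rw [map_smul, coeffDer_smul_constMul D a (contract_mem_constMul hφ h),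
      coeffDer_smul_constMul D a h, map_smul]
  | add x y hx hy => simp only [map_add, hx, hy]

/-- Iterated Leibniz rule, with the differentiated factor moved to the front at the cost of the sign
`(-1)ⁱ`. -/
theorem coeffDer_ιMulti (D : Derivation ℤ A A) {s : ℕ} (w : Fin (s + 1) → E) :
    coeffDer (b.exteriorPower (s + 1)) D (exteriorPower.ιMulti A (s + 1) w) =
      ∑ i : Fin (s + 1), (-1 : ℤ) ^ (i : ℕ) •
        wedge s (coeffDer b D (w i)) (exteriorPower.ιMulti A s (i.removeNth w)) := by
  have hw {r : ℕ} (w : Fin (r + 1) → E) : exteriorPower.ιMulti A (r + 1) w =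
      wedge r (w 0) (exteriorPower.ιMulti A r (Fin.tail w)) := by
    rw [wedge_ιMulti, Matrix.vecCons, Fin.cons_self_tail]
  induction s with
  | zero =>
    have h0 : exteriorPower.ιMulti A 0 (Fin.tail w) ∈ constMul b 0 := by
      convert! ιMulti_mem_constMul (b := b) (A := A) (![] : Fin 0 → ι)
    rw [hw, coeffDer_wedge, coeffDer_constMul D h0]
    simp [Fin.removeNth_zero]
  | succ s ih =>
    rw [hw, coeffDer_wedge, ih, map_sum, Fin.sum_univ_succ (n := s + 1)]
    congr 1
    · rw [Fin.removeNth_zero, Fin.val_zero, pow_zero, one_zsmul]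
    · refine Finset.sum_congr rfl fun j _ => ?_
      -- The differentiated factor passes in front of `w 0`, which accounts for the extra sign.
      rw [map_zsmul, wedge_wedge_comm, Fin.val_succ, pow_succ, hw (j.succ.removeNth w)]
      have h0 : j.succ.removeNth w 0 = w 0 := by simp [Fin.removeNth]
      have ht : Fin.tail (j.succ.removeNth w) = j.removeNth (Fin.tail w) := by
        ext i
        simp [Fin.removeNth, Fin.tail]
      simp only [mul_neg, mul_one, neg_smul, smul_neg, h0, ht]
      rfl

/-- The elements `x ⊗ θ` with `θ` an exterior product of basis vectors generate `X ⊗ ∧ˢ E`. -/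
theorem tmul_constMul_induction {X : Type*} [AddCommGroup X] [Module A X] {s : ℕ}
    {p : X ⊗[A] ⋀[A]^s E → Prop}
    (tmul : ∀ x, ∀ θ ∈ constMul b s, p (x ⊗ₜ θ))
    (add : ∀ x y, p x → p y → p (x + y)) (z : X ⊗[A] ⋀[A]^s E) : p z := by
  induction z using TensorProduct.induction_on with
  | zero => simpa using tmul 0 0 (zero_mem _)
  | tmul x θ =>
    induction θ using constMul_induction (b := b) with
    | smul_const a θ h => rw [← TensorProduct.smul_tmul]; exact tmul _ _ h
    | add θ θ' h h' => rw [TensorProduct.tmul_add]; exact add _ _ h h'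
  | add x y hx hy => exact add _ _ hx hy

end Constant

/-! ### Additive maps applied to components -/

section ComponentExtension

variable {A : Type u} [CommRing A] {E : Type u} [AddCommGroup E] [Module A E]
  {ι : Type*} [LinearOrder ι] [Fintype ι] (b : Basis ι A E)
  {X : Type*} [AddCommGroup X] [Module A X]

/-- An additive map applied to the components of an element of `X ⊗ ∧ˢ E`. -/
noncomputable def componentExt (S : X →+ X) (s : ℕ) : X ⊗[A] ⋀[A]^s E →+ X ⊗[A] ⋀[A]^s E :=
  TensorProduct.liftAddHom
    (AddMonoidHom.mk' (fun x => AddMonoidHom.mk'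
        (fun θ => ∑ I, S ((b.exteriorPower s).repr θ I • x) ⊗ₜ[A] b.exteriorPower s I)
        (fun θ θ' => by
          simp only [map_add, Finsupp.add_apply, add_smul, TensorProduct.add_tmul,
            Finset.sum_add_distrib]))
      (fun x x' => AddMonoidHom.ext fun θ => by
        simp only [AddMonoidHom.mk'_apply, AddMonoidHom.add_apply, smul_add, map_add,
          TensorProduct.add_tmul, Finset.sum_add_distrib]))
    (fun a x θ => by
      simp only [AddMonoidHom.mk'_apply, map_smul, Finsupp.smul_apply, smul_eq_mul, mul_smul,
        smul_comm a])

variable {b}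

/-- For `S` merely additive, `x ⊗ θ ↦ S x ⊗ θ` is not balanced over `A`, which forces the definition
by components. On constant `θ` the formula is nevertheless correct, since `S` commutes with
integers. -/
theorem componentExt_constMul (S : X →+ X) {s : ℕ} (x : X) {θ : ⋀[A]^s E}
    (h : θ ∈ constMul b s) : componentExt b S s (x ⊗ₜ θ) = S x ⊗ₜ θ := by
  have hS : ∀ I, S ((b.exteriorPower s).repr θ I • x) = (b.exteriorPower s).repr θ I • S x :=
    fun I => by
      obtain ⟨c, hc⟩ := repr_constMul h I
      rw [hc, Int.cast_smul_eq_zsmul, Int.cast_smul_eq_zsmul, map_zsmul]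
  conv_rhs => rw [← (b.exteriorPower s).sum_repr θ, TensorProduct.tmul_sum]
  simp only [componentExt, TensorProduct.liftAddHom_tmul, AddMonoidHom.mk'_apply, hS,
    TensorProduct.smul_tmul]

end ComponentExtension

/-! ### The Spencer complex as a Koszul complex -/

section SpencerComplex

variable {n : ℕ} {A : Type u} [CommRing A] (δ : CommutingDerivations n A)
  (M : Type v) [AddCommGroup M] [Module A M] [Module (DiffOp δ) M] [IsScalarTower A (DiffOp δ) M]

theorem coframe_frame (k i : Fin n) :
    coframe n A k (frame n A i) = if i = k then 1 else 0 :=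
  (frame n A).dualBasis_apply_self k i

theorem coframe_frame_int (k i : Fin n) : ∃ c : ℤ, coframe n A k (frame n A i) = c :=
  ⟨if i = k then 1 else 0, by rw [coframe_frame]; split_ifs <;> simp⟩

theorem spencerAdd_tmul (r : ℕ) (x : Induced δ M) (θ : ⋀[A]^(r + 1) (Tan n A)) :
    spencerAdd δ M r (x ⊗ₜ θ) = ∑ k, (rightAct δ M k x ⊗ₜ[A] contract r (coframe n A k) θ
      - x ⊗ₜ[A] contract r (coframe n A k) (multivecDer δ (r + 1) k θ)) := rfl

/-- The correction term of `d*` differentiates `θ`, so on constant `θ` only the Koszul differential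
is left. -/
theorem spencerAdd_constMul (r : ℕ) (x : Induced δ M) {θ : ⋀[A]^(r + 1) (Tan n A)}
    (h : θ ∈ constMul (frame n A) (r + 1)) :
    spencerAdd δ M r (x ⊗ₜ θ) = ∑ k, rightAct δ M k x ⊗ₜ[A] contract r (coframe n A k) θ := by
  rw [spencerAdd_tmul]
  refine Finset.sum_congr rfl fun k _ => ?_
  rw [multivecDer, coeffDer_constMul _ h, map_zero, TensorProduct.tmul_zero, sub_zero]

theorem rightAct_comm (i j : Fin n) (x : Induced δ M) :
    rightAct δ M i (rightAct δ M j x) = rightAct δ M j (rightAct δ M i x) := by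
  induction x using TensorProduct.induction_on with
  | zero => simp
  | tmul P m =>
    rw [show P = RightDiffOp.of δ P.op from rfl]
    simp only [rightAct_tmul, map_sub, mul_assoc, d_smul_d_smul δ i j m, DiffOp.d_mul_d δ i j]
    abel
  | add x y hx hy => simp only [map_add, hx, hy]

/-- On constant `θ` the square is a double sum in which the right actions commute and the
contractions anticommute. -/
theorem spencerAdd_spencerAdd (r : ℕ) (y : Induced δ M ⊗[A] ⋀[A]^(r + 2) (Tan n A)) :
    spencerAdd δ M r (spencerAdd δ M (r + 1) y) = 0 := by
  refine tmul_constMul_induction (b := frame n A)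
    (p := fun y => spencerAdd δ M r (spencerAdd δ M (r + 1) y) = 0)
    (fun x θ h => ?_) (fun x y hx hy => ?_) y
  · have hc : ∀ k, contract (r + 1) (coframe n A k) θ ∈ constMul (frame n A) (r + 1) :=
      fun k => contract_mem_constMul (coframe_frame_int k) h
    simp only [spencerAdd_constMul δ M (r + 1) x h, map_sum, spencerAdd_constMul δ M r _ (hc _)]
    refine sum_sum_eq_zero_of_antisymm _ (fun i => ?_) (fun i j => ?_)
    · rw [contract_contract_self, TensorProduct.tmul_zero]
    · rw [contract_contract_comm, rightAct_comm, TensorProduct.tmul_neg]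
  · rw [map_add, map_add, hx, hy, add_zero]

/-- The subgroup generated by the `x ⊗ d_{i₁} ∧ … ∧ d_{iᵣ}` with all `iₖ` outside of `s`. -/
noncomputable def avoiding (r : ℕ) (s : Finset (Fin n)) :
    AddSubgroup (Induced δ M ⊗[A] ⋀[A]^r (Tan n A)) :=
  AddSubgroup.closure {y | ∃ (x : Induced δ M) (f : Fin r → Fin n), (∀ i, f i ∉ s) ∧
    y = x ⊗ₜ exteriorPower.ιMulti A r (frame n A ∘ f)}

theorem mem_avoiding_empty (r : ℕ) (y : Induced δ M ⊗[A] ⋀[A]^r (Tan n A)) :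
    y ∈ avoiding δ M r ∅ := by
  refine tmul_constMul_induction (b := frame n A) (fun x θ h => ?_)
    (fun x y hx hy => add_mem hx hy) y
  · induction h using AddSubgroup.closure_induction with
    | mem θ h =>
      obtain ⟨f, rfl⟩ := h
      exact AddSubgroup.subset_closure ⟨x, f, fun _ => Finset.notMem_empty _, rfl⟩
    | zero => rw [TensorProduct.tmul_zero]; exact zero_mem _
    | add θ θ' _ _ h h' => rw [TensorProduct.tmul_add]; exact add_mem h h'
    | neg θ _ h => rw [TensorProduct.tmul_neg]; exact neg_mem h

/-- The degree is positive, so each generator would have a factor `f 0` outside of the whole index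
set. -/
theorem avoiding_univ (r : ℕ) : avoiding δ M (r + 1) Finset.univ = ⊥ := by
  rw [avoiding, AddSubgroup.closure_eq_bot_iff]
  rintro y ⟨x, f, hf, -⟩
  exact absurd (Finset.mem_univ _) (hf 0)

theorem contract_frame_of_notMem {r : ℕ} (k : Fin n) (f : Fin (r + 1) → Fin n)
    (h : ∀ i, f i ≠ k) :
    contract r (coframe n A k) (exteriorPower.ιMulti A (r + 1) (frame n A ∘ f)) = 0 := by
  rw [contract_ιMulti]
  refine Finset.sum_eq_zero fun j _ => ?_
  rw [Function.comp_apply, coframe_frame, if_neg (h j), zero_smul, smul_zero]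

theorem wedge_frame_of_mem {r : ℕ} (k : Fin n) (f : Fin r → Fin n) {i : Fin r} (h : f i = k) :
    wedge r (frame n A k) (exteriorPower.ιMulti A r (frame n A ∘ f)) = 0 := by
  rw [wedge_ιMulti]
  refine AlternatingMap.map_eq_zero_of_eq _ _ (i := 0) (j := i.succ) ?_ (Fin.succ_ne_zero i).symm
  simp [h]

/-! ### The homotopy removing one direction -/

section Homotopy

variable {δ M} {k : Fin n} {S : Induced δ M →+ Induced δ M}
  (hk : ∀ x, S (rightAct δ M k x) = x)
  (hj : ∀ j, j ≠ k → ∀ x, S (rightAct δ M j x) = rightAct δ M j (S x))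

/-- The homotopy `x ⊗ θ ↦ S x ⊗ d_k ∧ θ` (on components) of the Spencer complex. -/
noncomputable def spencerHomotopy (k : Fin n) (S : Induced δ M →+ Induced δ M) (r : ℕ) :
    Induced δ M ⊗[A] ⋀[A]^r (Tan n A) →+ Induced δ M ⊗[A] ⋀[A]^(r + 1) (Tan n A) :=
  (LinearMap.lTensor (Induced δ M) (wedge r (frame n A k))).toAddMonoidHom.comp
    (componentExt (frame n A) S r)

theorem spencerHomotopy_constMul (r : ℕ) (x : Induced δ M) {θ : ⋀[A]^r (Tan n A)}
    (h : θ ∈ constMul (frame n A) r) :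
    spencerHomotopy k S r (x ⊗ₜ θ) = S x ⊗ₜ wedge r (frame n A k) θ := by
  simp [spencerHomotopy, componentExt_constMul S x h]

include hk hj in
-- For `j ≠ k`, contraction with `dxʲ` anticommutes with `dₖ ∧` while `S` commutes with `x ↦ x dⱼ`,
-- so the contributions of `j` cancel. The direction `k` alone gives `S x dₖ ⊗ (θ - dₖ ∧ i(dxᵏ) θ) +
-- x ⊗ dₖ ∧ i(dxᵏ) θ`, and the difference from `x ⊗ θ` factors.
theorem sub_homotopy_constMul (r : ℕ) (x : Induced δ M) {θ : ⋀[A]^(r + 1) (Tan n A)}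
    (h : θ ∈ constMul (frame n A) (r + 1)) :
    x ⊗ₜ θ - spencerAdd δ M (r + 1) (spencerHomotopy k S (r + 1) (x ⊗ₜ θ))
      - spencerHomotopy k S r (spencerAdd δ M r (x ⊗ₜ θ)) =
    (x - rightAct δ M k (S x)) ⊗ₜ
      (θ - wedge r (frame n A k) (contract r (coframe n A k) θ)) := by
  have hc : ∀ j, contract r (coframe n A j) θ ∈ constMul (frame n A) r :=
    fun j => contract_mem_constMul (coframe_frame_int j) h
  rw [spencerHomotopy_constMul _ _ h, spencerAdd_constMul _ _ _ _ (wedge_mem_constMul k h),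
    spencerAdd_constMul _ _ _ _ h, map_sum, sub_sub, ← Finset.sum_add_distrib,
    ← Finset.add_sum_erase _ _ (Finset.mem_univ k)]
  rw [Finset.sum_eq_zero (s := Finset.univ.erase k), add_zero]
  · rw [spencerHomotopy_constMul _ _ (hc k), hk, contract_wedge, coframe_frame, if_pos rfl,
      one_smul]
    simp only [TensorProduct.tmul_sub, TensorProduct.sub_tmul]
    abel
  · intro j hjk
    have hjk := Finset.ne_of_mem_erase hjk
    rw [spencerHomotopy_constMul _ _ (hc j), hj j hjk, contract_wedge, coframe_frame,
      if_neg hjk.symm, zero_smul, zero_sub, TensorProduct.tmul_neg, neg_add_cancel]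

include hk hj in
-- The map `θ ↦ θ - dₖ ∧ i(dxᵏ) θ` kills the products containing `dₖ` and fixes the others, so a new
-- direction is removed and none of those in `s` comes back.
theorem sub_homotopy_mem_avoiding (r : ℕ) {s : Finset (Fin n)}
    {y : Induced δ M ⊗[A] ⋀[A]^(r + 1) (Tan n A)} (h : y ∈ avoiding δ M (r + 1) s) :
    y - spencerAdd δ M (r + 1) (spencerHomotopy k S (r + 1) y)
      - spencerHomotopy k S r (spencerAdd δ M r y) ∈ avoiding δ M (r + 1) (insert k s) := by
  induction h using AddSubgroup.closure_induction with
  | mem y h =>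
    obtain ⟨x, f, hf, rfl⟩ := h
    have hθ := ιMulti_mem_constMul (A := A) (b := frame n A) f
    rw [sub_homotopy_constMul hk hj r x hθ]
    by_cases hm : ∃ i, f i = k
    · obtain ⟨i, hi⟩ := hm
      -- If `dₖ` occurs in `θ`, then `dₖ ∧ θ = 0`, and contracting this with `dxᵏ` gives `θ = dₖ ∧
      -- i(dxᵏ) θ`.
      have h := contract_wedge r (coframe n A k) (frame n A k)
        (exteriorPower.ιMulti A (r + 1) (frame n A ∘ f))
      rw [wedge_frame_of_mem k f hi, map_zero, coframe_frame, if_pos rfl, one_smul] at h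
      rw [← h, TensorProduct.tmul_zero]
      exact zero_mem _
    · push Not at hm
      rw [contract_frame_of_notMem k f hm, map_zero, sub_zero]
      refine AddSubgroup.subset_closure ⟨_, f, fun i hi => ?_, rfl⟩
      rcases Finset.mem_insert.1 hi with hi | hi
      · exact hm i hi
      · exact hf i hi
  | zero => simp
  | add x y _ _ hx hy =>
    convert! add_mem hx hy using 1
    simp only [map_add]
    abel
  | neg x _ hx =>
    convert! neg_mem hx using 1
    simp only [map_neg]
    abel

end Homotopy

variable {δ M} in
/-- If every `x ↦ x dₖ` has a left inverse commuting with the other `x ↦ x dⱼ`, then the Spencer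
complex is exact in positive degrees. -/
theorem exists_spencerAdd_eq {S : Fin n → Induced δ M →+ Induced δ M}
    (hk : ∀ k x, S k (rightAct δ M k x) = x)
    (hj : ∀ k j, j ≠ k → ∀ x, S k (rightAct δ M j x) = rightAct δ M j (S k x))
    (r : ℕ) {y : Induced δ M ⊗[A] ⋀[A]^(r + 1) (Tan n A)} (hy : spencerAdd δ M r y = 0) :
    ∃ z, spencerAdd δ M (r + 1) z = y := by
  have key : ∀ s : Finset (Fin n), ∃ z,
      y - spencerAdd δ M (r + 1) z ∈ avoiding δ M (r + 1) s := fun s => by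
    induction s using Finset.induction_on with
    | empty => exact ⟨0, mem_avoiding_empty δ M _ _⟩
    | insert k s _ ih =>
      obtain ⟨z, hz⟩ := ih
      -- The remainder is again a cycle, so the term `h d*` of the homotopy formula vanishes and the
      -- correction is a boundary.
      refine ⟨z + spencerHomotopy k (S k) (r + 1) (y - spencerAdd δ M (r + 1) z), ?_⟩
      have h := sub_homotopy_mem_avoiding (hk k) (hj k) r hz
      have h0 : spencerAdd δ M r (y - spencerAdd δ M (r + 1) z) = 0 := by
        rw [map_sub, hy, spencerAdd_spencerAdd, sub_zero]
      rw [h0, map_zero, sub_zero] at h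
      rwa [map_add, ← sub_sub]
  obtain ⟨z, hz⟩ := key Finset.univ
  rw [avoiding_univ] at hz
  exact ⟨z, (sub_eq_zero.1 hz).symm⟩

end SpencerComplex

/-! ### Polynomials with coefficients in `M` -/

section PolyMod

variable (n : ℕ) (M : Type v) [AddCommGroup M]

/-- Polynomials in `n` variables with coefficients in `M`. -/
def PolyMod : Type v := (Fin n →₀ ℕ) →₀ M

namespace PolyMod

noncomputable instance : AddCommGroup (PolyMod n M) :=
  inferInstanceAs (AddCommGroup ((Fin n →₀ ℕ) →₀ M))

noncomputable instance {A : Type u} [CommRing A] [Module A M] : Module A (PolyMod n M) :=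
  inferInstanceAs (Module A ((Fin n →₀ ℕ) →₀ M))

variable {n M}

/-- The monomial `m X^α`. -/
noncomputable def mono (α : Fin n →₀ ℕ) : M →+ PolyMod n M := Finsupp.singleAddHom α

theorem induction {p : PolyMod n M → Prop} (mono : ∀ α m, p (mono α m))
    (add : ∀ f g, p f → p g → p (f + g)) (f : PolyMod n M) : p f := by
  refine Finsupp.induction_linear (motive := p) f ?_ add mono
  have h := mono 0 0
  rwa [map_zero] at h

variable (M) in
/-- Multiplication by `X_k`. -/
noncomputable def mulX (k : Fin n) : PolyMod n M →+ PolyMod n M :=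
  Finsupp.mapDomain.addMonoidHom (M := M) (fun α : Fin n →₀ ℕ => α + Finsupp.single k 1)

variable (M) in
/-- Division by `X_k`, forgetting the remainder. -/
noncomputable def divX (k : Fin n) : PolyMod n M →+ PolyMod n M :=
  Finsupp.comapDomain.addMonoidHom (M := M) (f := fun α : Fin n →₀ ℕ => α + Finsupp.single k 1)
    (add_left_injective _)

/-- An additive map applied to the coefficients. -/
noncomputable def mapCoeff (g : M →+ M) : PolyMod n M →+ PolyMod n M :=
  Finsupp.mapRange.addMonoidHom g

theorem mulX_mono (k : Fin n) (α : Fin n →₀ ℕ) (m : M) :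
    mulX M k (mono α m) = mono (α + Finsupp.single k 1) m :=
  Finsupp.mapDomain_single

theorem mapCoeff_mono (g : M →+ M) (α : Fin n →₀ ℕ) (m : M) :
    mapCoeff g (mono α m) = mono α (g m) :=
  Finsupp.mapRange_single (hf := map_zero g)

theorem smul_mono {A : Type u} [CommRing A] [Module A M] (a : A) (α : Fin n →₀ ℕ) (m : M) :
    a • mono α m = mono α (a • m) :=
  Finsupp.smul_single a α m

theorem divX_mulX (k : Fin n) (f : PolyMod n M) : divX M k (mulX M k f) = f :=
  Finsupp.comapDomain_mapDomain _ (add_left_injective _) f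

theorem divX_mono_of_eq_zero {k : Fin n} {α : Fin n →₀ ℕ} (h : α k = 0) (m : M) :
    divX M k (mono α m) = 0 := by
  refine Finsupp.ext fun β => ?_
  change Finsupp.single α m (β + Finsupp.single k 1) = 0
  rw [Finsupp.single_apply, if_neg]
  rintro rfl
  simp at h

/-- On a monomial, either `Xₖ` does not divide it, and then it does not divide its product with `Xⱼ`
either, or a factor `Xₖ` can be split off and cancelled on both sides. -/
theorem divX_mulX_of_ne {k j : Fin n} (h : j ≠ k) (f : PolyMod n M) :
    divX M k (mulX M j f) = mulX M j (divX M k f) := by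
  induction f using induction with
  | mono α m =>
    by_cases hα : α k = 0
    · rw [divX_mono_of_eq_zero hα, map_zero, mulX_mono, divX_mono_of_eq_zero]
      simp [hα, h]
    · obtain ⟨β, rfl⟩ : ∃ β, α = β + Finsupp.single k 1 :=
        ⟨α - Finsupp.single k 1, (tsub_add_cancel_of_le (by simpa using by omega)).symm⟩
      rw [← mulX_mono, divX_mulX, mulX_mono, mulX_mono, mulX_mono, add_right_comm, ← mulX_mono,
        divX_mulX]
  | add f g hf hg => simp only [map_add, hf, hg]

theorem mulX_comm (i j : Fin n) (f : PolyMod n M) :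
    mulX M i (mulX M j f) = mulX M j (mulX M i f) := by
  induction f using induction with
  | mono α m => simp only [mulX_mono, add_right_comm]
  | add f g hf hg => simp only [map_add, hf, hg]

theorem mulX_mapCoeff (i : Fin n) (g : M →+ M) (f : PolyMod n M) :
    mulX M i (mapCoeff g f) = mapCoeff g (mulX M i f) := by
  induction f using induction with
  | mono α m => simp only [mulX_mono, mapCoeff_mono]
  | add f g hf hg => simp only [map_add, hf, hg]

end PolyMod

end PolyMod

/-! ### Comparison of `D ⊗_A M` with polynomials -/

section Induced

variable {n : ℕ} {A : Type u} [CommRing A] (δ : CommutingDerivations n A)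
  (M : Type v) [AddCommGroup M] [Module A M] [Module (DiffOp δ) M] [IsScalarTower A (DiffOp δ) M]

namespace PolyMod

/-- The left action `X_i + d_i` of `d_i` on polynomials with coefficients in `M`. -/
noncomputable def dAct (i : Fin n) : PolyMod n M →+ PolyMod n M :=
  mulX M i + mapCoeff (DistribSMul.toAddMonoidHom M (DiffOp.d δ i))

theorem dAct_mono (i : Fin n) (α : Fin n →₀ ℕ) (m : M) :
    dAct δ M i (mono α m) = mono (α + Finsupp.single i 1) m + mono α (DiffOp.d δ i • m) := by
  simp [dAct, mulX_mono, mapCoeff_mono]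

theorem mulX_dAct (i j : Fin n) (f : PolyMod n M) :
    mulX M i (dAct δ M j f) = dAct δ M j (mulX M i f) := by
  simp only [dAct, AddMonoidHom.add_apply, map_add, mulX_comm i j, mulX_mapCoeff]

theorem dAct_smul (i : Fin n) (a : A) (f : PolyMod n M) :
    dAct δ M i (a • f) = a • dAct δ M i f + δ.der i a • f := by
  induction f using induction with
  | mono α m =>
    simp only [smul_mono, dAct_mono, smul_add, d_smul_smul, map_add]
    abel
  | add f g hf hg => simp only [smul_add, map_add, hf, hg]; abel

theorem dAct_comm (i j : Fin n) (f : PolyMod n M) :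
    dAct δ M i (dAct δ M j f) = dAct δ M j (dAct δ M i f) := by
  induction f using induction with
  | mono α m =>
    simp only [dAct_mono, map_add, d_smul_d_smul δ i j m,
      add_right_comm α (Finsupp.single i 1)]
    abel
  | add f g hf hg => simp only [map_add, hf, hg]

noncomputable instance : Module (DiffOp δ) (PolyMod n M) :=
  moduleOfAction δ (dAct δ M) (dAct_smul δ M) (dAct_comm δ M)

instance : IsScalarTower A (DiffOp δ) (PolyMod n M) :=
  moduleOfAction_tower δ (dAct δ M) (dAct_smul δ M) (dAct_comm δ M)

theorem d_smul_eq (i : Fin n) (f : PolyMod n M) : DiffOp.d δ i • f = dAct δ M i f :=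
  moduleOfAction_d δ (dAct δ M) (dAct_smul δ M) (dAct_comm δ M) i f

/-- Multiplication by `Xₖ` commutes with `a` and with `Xᵢ + dᵢ`, hence with all of `D`; it can
therefore play the role of the right action of `dₖ`. -/
theorem mulX_smul (k : Fin n) (P : DiffOp δ) (f : PolyMod n M) :
    mulX M k (P • f) = P • mulX M k f := by
  induction P using DiffOp.induction generalizing f with
  | hA a =>
    rw [ofA_smul, ofA_smul]
    induction f using induction with
    | mono α m => simp only [mulX_mono, smul_mono]
    | add f g hf hg => simp only [map_add, smul_add, hf, hg]
  | hd i => rw [d_smul_eq, d_smul_eq, mulX_dAct]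
  | hadd P Q hP hQ => rw [add_smul, add_smul, map_add, hP, hQ]
  | hmul P Q hP hQ => rw [mul_smul, mul_smul, hP, hQ]

end PolyMod

/-- The map `P ⊗ m ↦ P m` from `D ⊗_A M` to the polynomials with coefficients in `M`. -/
noncomputable def toPoly : Induced δ M →+ PolyMod n M :=
  TensorProduct.liftAddHom
    (AddMonoidHom.mk' (fun P => AddMonoidHom.mk' (fun m => P.op • PolyMod.mono 0 m)
        (fun m m' => by rw [map_add, smul_add]))
      (fun P P' => AddMonoidHom.ext fun m => by
        simpa using! add_smul P.op P'.op (PolyMod.mono 0 m : PolyMod n M)))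
    (fun a P m => by
      change (P.op * DiffOp.ofA δ a) • (PolyMod.mono 0 m : PolyMod n M) =
        P.op • PolyMod.mono 0 (a • m)
      rw [mul_smul, ofA_smul, PolyMod.smul_mono])

theorem toPoly_tmul (P : DiffOp δ) (m : M) :
    toPoly δ M (RightDiffOp.of δ P ⊗ₜ m) = P • (PolyMod.mono 0 m : PolyMod n M) := rfl

/-- On `1 ⊗ m` this is `(Xₖ + dₖ) m - dₖ m = Xₖ m`; the factor `P` passes through because `Xₖ` is
`D`-linear. -/
theorem toPoly_rightAct (k : Fin n) (x : Induced δ M) :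
    toPoly δ M (rightAct δ M k x) = PolyMod.mulX M k (toPoly δ M x) := by
  induction x using TensorProduct.induction_on with
  | zero => simp
  | tmul P m =>
    rw [show P = RightDiffOp.of δ P.op from rfl, rightAct_tmul, map_sub, toPoly_tmul,
      toPoly_tmul, toPoly_tmul, PolyMod.mulX_smul, mul_smul, PolyMod.d_smul_eq,
      PolyMod.dAct_mono, PolyMod.mulX_mono, smul_add, add_sub_cancel_right]
  | add x y hx hy => simp only [map_add, hx, hy]

/-- The operator `x ↦ x d_k`, as an element of the ring of additive endomorphisms. -/
noncomputable def rightEnd (k : Fin n) : AddMonoid.End (Induced δ M) := rightAct δ M k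

theorem rightEnd_commute (i j : Fin n) : Commute (rightEnd δ M i) (rightEnd δ M j) :=
  AddMonoidHom.ext fun x => rightAct_comm δ M i j x

/-- The action of the monomials in the `x ↦ x d_k`. -/
noncomputable def rightPow :
    (Fin n → Multiplicative ℕ) →* AddMonoid.End (Induced δ M) :=
  MonoidHom.noncommPiCoprod (fun k => powersHom (AddMonoid.End (Induced δ M)) (rightEnd δ M k))
    (fun i j _ _ _ => (rightEnd_commute δ M i j).pow_pow _ _)

/-- The operator `x ↦ x d^α`. -/
noncomputable def rightMono (α : Fin n →₀ ℕ) : AddMonoid.End (Induced δ M) :=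
  rightPow δ M fun i => Multiplicative.ofAdd (α i)

theorem rightMono_zero : rightMono δ M 0 = 1 :=
  map_one (rightPow δ M)

theorem rightMono_add (α β : Fin n →₀ ℕ) :
    rightMono δ M (α + β) = rightMono δ M α * rightMono δ M β :=
  map_mul (rightPow δ M) _ _

theorem rightMono_single (k : Fin n) (c : ℕ) :
    rightMono δ M (Finsupp.single k c) = rightEnd δ M k ^ c := by
  have h : (fun i => Multiplicative.ofAdd (Finsupp.single k c i)) =
      Pi.mulSingle k (Multiplicative.ofAdd c) := by
    funext i
    by_cases hi : i = k
    · subst hi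
      simp
    · simp [hi]
  rw [rightMono, h]
  exact MonoidHom.noncommPiCoprod_mulSingle (N := fun _ => Multiplicative ℕ) _ k
    (Multiplicative.ofAdd c)

/-- Used twice: with `g` the left multiplication by an operator, and with `g` the right action of
some `dₖ`. -/
theorem commute_rightMono {g : AddMonoid.End (Induced δ M)}
    (h : ∀ k, Commute g (rightEnd δ M k)) (α : Fin n →₀ ℕ) : Commute g (rightMono δ M α) := by
  induction α using Finsupp.induction_linear with
  | zero => rw [rightMono_zero]; exact Commute.one_right g
  | add α β hα hβ => rw [rightMono_add]; exact hα.mul_right hβ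
  | single k c => rw [rightMono_single]; exact (h k).pow_right c

theorem rightMono_left (α : Fin n →₀ ℕ) (Q : DiffOp δ) (x : Induced δ M) :
    rightMono δ M α (Q • x) = Q • rightMono δ M α x :=
  (DFunLike.congr_fun (commute_rightMono δ M
    (g := (DistribSMul.toAddMonoidHom (Induced δ M) Q : Induced δ M →+ Induced δ M))
    (fun k => AddMonoidHom.ext fun x => (rightAct_left δ M k Q x).symm) α) x).symm

theorem rightAct_rightMono (k : Fin n) (α : Fin n →₀ ℕ) (x : Induced δ M) :
    rightAct δ M k (rightMono δ M α x) = rightMono δ M α (rightAct δ M k x) :=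
  DFunLike.congr_fun (commute_rightMono δ M (rightEnd_commute δ M k) α) x

theorem rightMono_add_single (α : Fin n →₀ ℕ) (k : Fin n) (x : Induced δ M) :
    rightMono δ M (α + Finsupp.single k 1) x = rightAct δ M k (rightMono δ M α x) := by
  rw [rightMono_add, rightMono_single, pow_one, rightAct_rightMono]
  rfl

/-- The map `m X^α ↦ (1 ⊗ m) d^α`. -/
noncomputable def ofPoly : PolyMod n M →+ Induced δ M :=
  Finsupp.liftAddHom (M := M) fun α =>
    (rightMono δ M α : Induced δ M →+ Induced δ M).comp
      ((TensorProduct.mk A (RightDiffOp δ) M (RightDiffOp.of δ 1)).toAddMonoidHom)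

theorem ofPoly_mono (α : Fin n →₀ ℕ) (m : M) :
    ofPoly δ M (PolyMod.mono α m) = rightMono δ M α (RightDiffOp.of δ 1 ⊗ₜ m) :=
  Finsupp.liftAddHom_apply_single _ _ _

theorem ofPoly_mulX (k : Fin n) (f : PolyMod n M) :
    ofPoly δ M (PolyMod.mulX M k f) = rightAct δ M k (ofPoly δ M f) := by
  induction f using PolyMod.induction with
  | mono α m => rw [PolyMod.mulX_mono, ofPoly_mono, rightMono_add_single, ofPoly_mono]
  | add f g hf hg => simp only [map_add, hf, hg]

/-- It suffices to treat the generators of `D`. For `dᵢ` the point is `dᵢ (1 ⊗ m) = (1 ⊗ m) dᵢ + 1 ⊗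
dᵢ m`, which mirrors the action `Xᵢ + dᵢ`. -/
theorem ofPoly_smul (P : DiffOp δ) (f : PolyMod n M) :
    ofPoly δ M (P • f) = P • ofPoly δ M f := by
  induction P using DiffOp.induction generalizing f with
  | hA a =>
    rw [ofA_smul]
    induction f using PolyMod.induction with
    | mono α m =>
      rw [PolyMod.smul_mono, ofPoly_mono, ofPoly_mono, ← rightMono_left, TensorProduct.tmul_smul,
        TensorProduct.smul_tmul', TensorProduct.smul_tmul', RightDiffOp.smul_of, one_mul]
      rw [show DiffOp.ofA δ a • RightDiffOp.of δ 1 = RightDiffOp.of δ (DiffOp.ofA δ a * 1) from rfl,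
        mul_one]
    | add f g hf hg => simp only [map_add, smul_add, hf, hg]
  | hd i =>
    rw [PolyMod.d_smul_eq]
    induction f using PolyMod.induction with
    | mono α m =>
      rw [PolyMod.dAct_mono, map_add, ← PolyMod.mulX_mono, ofPoly_mulX, ofPoly_mono, ofPoly_mono,
        ← rightMono_left, TensorProduct.smul_tmul',
        show DiffOp.d δ i • RightDiffOp.of δ 1 = RightDiffOp.of δ (1 * DiffOp.d δ i) from
          congrArg (RightDiffOp.of δ) ((mul_one _).trans (one_mul _).symm)]
      rw [rightAct_rightMono, rightAct_tmul, map_sub, sub_add_cancel]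
    | add f g hf hg => simp only [map_add, smul_add, hf, hg]
  | hadd P Q hP hQ => rw [add_smul, add_smul, map_add, hP, hQ]
  | hmul P Q hP hQ => rw [mul_smul, mul_smul, hP, hQ]

/-- By `D`-linearity it is enough to look at `1 ⊗ m`. This one-sided inverse is all that the
construction of `rightDiv` requires. -/
theorem ofPoly_toPoly (x : Induced δ M) : ofPoly δ M (toPoly δ M x) = x := by
  induction x using TensorProduct.induction_on with
  | zero => simp
  | tmul P m =>
    rw [show P = RightDiffOp.of δ P.op from rfl, toPoly_tmul, ofPoly_smul, ofPoly_mono,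
      rightMono_zero, AddMonoid.End.coe_one, id, TensorProduct.smul_tmul']
    exact congrArg (fun Q => RightDiffOp.of δ Q ⊗ₜ m) (mul_one _)
  | add x y hx hy => simp only [map_add, hx, hy]

/-- The left inverse of `x ↦ x d_k` given by the division by `X_k`. -/
noncomputable def rightDiv (k : Fin n) : Induced δ M →+ Induced δ M :=
  (ofPoly δ M).comp ((PolyMod.divX M k).comp (toPoly δ M))

theorem rightDiv_rightAct (k : Fin n) (x : Induced δ M) :
    rightDiv δ M k (rightAct δ M k x) = x := by
  change ofPoly δ M (PolyMod.divX M k (toPoly δ M _)) = x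
  rw [toPoly_rightAct, PolyMod.divX_mulX, ofPoly_toPoly]

theorem rightDiv_rightAct_of_ne (k j : Fin n) (h : j ≠ k) (x : Induced δ M) :
    rightDiv δ M k (rightAct δ M j x) = rightAct δ M j (rightDiv δ M k x) := by
  change ofPoly δ M (PolyMod.divX M k (toPoly δ M _)) =
    rightAct δ M j (ofPoly δ M (PolyMod.divX M k (toPoly δ M x)))
  rw [toPoly_rightAct, PolyMod.divX_mulX_of_ne h, ofPoly_mulX]

/-- `P ⊗ m` is congruent to `1 ⊗ P m` modulo the sums of the `x d_k`. -/
theorem exists_eq_one_tmul_add (x : Induced δ M) : ∃ y : Fin n → Induced δ M,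
    x = RightDiffOp.of δ 1 ⊗ₜ augAdd δ M x + ∑ k, rightAct δ M k (y k) := by
  -- The additional left factor `Q` lets the induction on `P` pass through products: `Q P P' ⊗ m ≡ Q
  -- P ⊗ P' m ≡ Q ⊗ P P' m`.
  have key : ∀ (P Q : DiffOp δ) (m : M), ∃ y : Fin n → Induced δ M,
      RightDiffOp.of δ (Q * P) ⊗ₜ m =
        RightDiffOp.of δ Q ⊗ₜ (P • m) + ∑ k, rightAct δ M k (y k) := fun P => by
    induction P using DiffOp.induction with
    | hA a =>
      intro Q m
      refine ⟨0, ?_⟩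
      simp only [Pi.zero_apply, map_zero, Finset.sum_const_zero, add_zero, ofA_smul,
        TensorProduct.tmul_smul, TensorProduct.smul_tmul', RightDiffOp.smul_of]
    | hd i =>
      intro Q m
      refine ⟨Pi.single i (RightDiffOp.of δ Q ⊗ₜ m), ?_⟩
      rw [Finset.sum_eq_single i (fun j _ h => by rw [Pi.single_eq_of_ne h, map_zero]) (by simp),
        Pi.single_eq_same, rightAct_tmul]
      abel
    | hadd P P' h h' =>
      intro Q m
      obtain ⟨y, hy⟩ := h Q m
      obtain ⟨y', hy'⟩ := h' Q m
      refine ⟨y + y', ?_⟩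
      rw [mul_add, show RightDiffOp.of δ (Q * P + Q * P') =
        RightDiffOp.of δ (Q * P) + RightDiffOp.of δ (Q * P') from rfl, TensorProduct.add_tmul, hy,
        hy', add_smul, TensorProduct.tmul_add]
      simp only [Pi.add_apply, map_add, Finset.sum_add_distrib]
      abel
    | hmul P P' h h' =>
      intro Q m
      obtain ⟨y', hy'⟩ := h' (Q * P) m
      obtain ⟨y, hy⟩ := h Q (P' • m)
      refine ⟨y + y', ?_⟩
      rw [← mul_assoc, hy', hy, mul_smul]
      simp only [Pi.add_apply, map_add, Finset.sum_add_distrib]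
      abel
  induction x using TensorProduct.induction_on with
  | zero => exact ⟨0, by simp⟩
  | tmul P m =>
    obtain ⟨y, hy⟩ := key P.op 1 m
    rw [one_mul] at hy
    exact ⟨y, hy⟩
  | add x x' hx hx' =>
    obtain ⟨y, hy⟩ := hx
    obtain ⟨y', hy'⟩ := hx'
    refine ⟨y + y', ?_⟩
    simp only [Pi.add_apply, map_add, Finset.sum_add_distrib, TensorProduct.tmul_add]
    conv_lhs => rw [hy, hy']
    abel

end Induced

/-! ### The de Rham complex and the solutions -/

section DeRhamComplex

variable {A : Type u} [CommRing A]

theorem constMul_tmul_induction {E : Type u} [AddCommGroup E] [Module A E] {ι : Type*}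
    [LinearOrder ι] [Fintype ι] {b : Basis ι A E} {X : Type*} [AddCommGroup X] [Module A X] {s : ℕ}
    {p : ⋀[A]^s E ⊗[A] X → Prop}
    (tmul : ∀ θ ∈ constMul b s, ∀ x, p (θ ⊗ₜ x))
    (add : ∀ x y, p x → p y → p (x + y)) (z : ⋀[A]^s E ⊗[A] X) : p z := by
  have h := tmul_constMul_induction (b := b) (p := fun z => p (TensorProduct.comm A X _ z))
    (fun x θ h => tmul θ h x)
    (fun x y hx hy => by rw [map_add]; exact add _ _ hx hy) ((TensorProduct.comm A X _).symm z)
  rwa [LinearEquiv.apply_symm_apply] at h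

variable {n : ℕ} (δ : CommutingDerivations n A)
  (M : Type v) [AddCommGroup M] [Module A M] [Module (DiffOp δ) M] [IsScalarTower A (DiffOp δ) M]

theorem nabla_tmul (s : ℕ) (ω : ⋀[A]^s (Cot n A)) (m : M) :
    nabla δ M s (ω ⊗ₜ[A] m) = extDer δ s ω ⊗ₜ[A] m +
      ∑ i, wedge s (coframe n A i) ω ⊗ₜ[A] (DiffOp.d δ i • m) := rfl

theorem nabla_constMul (s : ℕ) {ω : ⋀[A]^s (Cot n A)} (h : ω ∈ constMul (coframe n A) s) (m : M) :
    nabla δ M s (ω ⊗ₜ[A] m) = ∑ i, wedge s (coframe n A i) ω ⊗ₜ[A] (DiffOp.d δ i • m) := by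
  have h0 : extDer δ s ω = 0 := by
    rw [extDer_apply]
    exact Finset.sum_eq_zero fun i _ => by rw [formDer, coeffDer_constMul _ h, map_zero]
  rw [nabla_tmul, h0, TensorProduct.zero_tmul, zero_add]

/-- On constant forms, the exterior multiplications by `dxⁱ` anticommute and the `dᵢ` commute on
`M`. -/
theorem nabla_nabla (s : ℕ) (x : ⋀[A]^s (Cot n A) ⊗[A] M) :
    nabla δ M (s + 1) (nabla δ M s x) = 0 := by
  refine constMul_tmul_induction (b := coframe n A)
    (p := fun x => nabla δ M (s + 1) (nabla δ M s x) = 0) (fun θ h m => ?_)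
    (fun x y hx hy => by rw [map_add, map_add, hx, hy, add_zero]) x
  simp only [nabla_constMul δ M s h, map_sum,
    nabla_constMul δ M (s + 1) (wedge_mem_constMul _ h)]
  refine sum_sum_eq_zero_of_antisymm (fun i j => wedge (s + 1) (coframe n A j)
    (wedge s (coframe n A i) θ) ⊗ₜ[A] (DiffOp.d δ j • DiffOp.d δ i • m)) (fun i => ?_) (fun i j => ?_)
  · simp only [wedge_wedge_self, TensorProduct.zero_tmul]
  · rw [wedge_wedge_comm, d_smul_d_smul, TensorProduct.neg_tmul]

theorem subsingleton_forms_tensor (M : Type v) [AddCommGroup M] [Module A M] {s : ℕ} (h : n < s) :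
    Subsingleton (⋀[A]^s (Cot n A) ⊗[A] M) := by
  have := subsingleton_exteriorPower (coframe n A) (s := s) (by simpa using h)
  infer_instance

/-- The isomorphism `∧⁰ E ⊗ X = X`. -/
noncomputable def zeroTensorEquiv (A : Type u) [CommRing A] (E : Type u) [AddCommGroup E]
    [Module A E] (X : Type*) [AddCommGroup X] [Module A X] : ⋀[A]^0 E ⊗[A] X ≃ₗ[A] X :=
  (LinearEquiv.rTensor X (exteriorPower.zeroEquiv (R := A) (M := E))).trans
    (TensorProduct.lid A X)

theorem zeroTensorEquiv_tmul {E : Type u} [AddCommGroup E] [Module A E] {X : Type*}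
    [AddCommGroup X] [Module A X] (f : Fin 0 → E) (x : X) :
    zeroTensorEquiv A E X (exteriorPower.ιMulti A 0 f ⊗ₜ x) = x := by
  simp [zeroTensorEquiv, exteriorPower.zeroEquiv_ιMulti]

theorem zeroTensorEquiv_symm_apply {E : Type u} [AddCommGroup E] [Module A E] {X : Type*}
    [AddCommGroup X] [Module A X] (f : Fin 0 → E) (x : X) :
    (zeroTensorEquiv A E X).symm x = exteriorPower.ιMulti A 0 f ⊗ₜ x :=
  (LinearEquiv.symm_apply_eq _).2 (zeroTensorEquiv_tmul f x).symm

theorem nabla_zero_eq_zero_iff (m : M) :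
    nabla δ M 0 (exteriorPower.ιMulti A 0 (M := Cot n A) ![] ⊗ₜ m) = 0 ↔
      ∀ i, DiffOp.d δ i • m = 0 := by
  have hc : exteriorPower.ιMulti A 0 (M := Cot n A) ![] ∈ constMul (coframe n A) 0 := by
    convert! ιMulti_mem_constMul (b := coframe n A) (A := A) (![] : Fin 0 → Fin n)
  rw [nabla_constMul δ M 0 hc]
  refine ⟨fun h k => ?_, fun h => Finset.sum_eq_zero fun i _ => by
    rw [h i, TensorProduct.tmul_zero]⟩
  -- Contraction with `dₖ`, viewed as a linear form on `T*`, isolates the coefficient of `dxᵏ`.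
  have h := congrArg (LinearMap.rTensor M
    (contract 0 (Module.Dual.eval A (Tan n A) (frame n A k)))) h
  simp only [map_sum, LinearMap.rTensor_tmul, contract_wedge_zero, Module.Dual.eval_apply,
    coframe_frame, map_zero] at h
  rw [Finset.sum_eq_single k (fun i _ hi => by
    rw [if_neg hi.symm, zero_smul, TensorProduct.zero_tmul]) (by simp), if_pos rfl, one_smul] at h
  have h := congrArg (zeroTensorEquiv A (Cot n A) M) h
  rwa [zeroTensorEquiv_tmul, map_zero] at h

theorem InvSystem.d_smul_apply (i : Fin n) (f : InvSystem A M) (m : M) :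
    (DiffOp.d δ i • f) m = δ.der i (f m) - f (DiffOp.d δ i • m) := by
  rw [HomA.d_smul_apply, d_smul_ring]

theorem solToDeRham_injective : Function.Injective (solToDeRham δ M) := fun f g h => by
  have h := congrArg (zeroTensorEquiv A (Cot n A) (InvSystem A M)) h
  rw [solToDeRham, solToDeRham, zeroTensorEquiv_tmul, zeroTensorEquiv_tmul] at h
  exact LinearMap.ext fun m => DFunLike.congr_fun h m

theorem exact_solToDeRham_nabla :
    Function.Exact (solToDeRham δ M) (nabla δ (InvSystem A M) 0) := fun x => by
  obtain ⟨f, rfl⟩ := (zeroTensorEquiv A (Cot n A) (InvSystem A M)).symm.surjective x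
  rw [zeroTensorEquiv_symm_apply ![], nabla_zero_eq_zero_iff]
  constructor
  · intro h
    -- Vanishing of the Spencer operator on `f` is precisely commutation of `f` with `dᵢ`.
    have hd : ∀ i (m : M), f (DiffOp.d δ i • m) = DiffOp.d δ i • f m := fun i m => by
      have h := DFunLike.congr_fun (h i) m
      rw [HomA.d_smul_apply] at h
      exact (sub_eq_zero.1 h).symm
    exact ⟨dLinear δ (f : M →ₗ[A] A) hd, rfl⟩
  · rintro ⟨g, hg⟩ i
    have hf := congrArg (zeroTensorEquiv A (Cot n A) (InvSystem A M)) hg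
    rw [solToDeRham, zeroTensorEquiv_tmul, zeroTensorEquiv_tmul] at hf
    subst hf
    refine DFunLike.ext _ _ fun m => ?_
    rw [HomA.d_smul_apply]
    exact sub_eq_zero.2 (map_smul g (DiffOp.d δ i) m).symm

end DeRhamComplex

/-! ### Exactness of the Spencer complex -/

section SpencerResolution

variable {n : ℕ} {A : Type u} [CommRing A] (δ : CommutingDerivations n A)
  (M : Type v) [AddCommGroup M] [Module A M] [Module (DiffOp δ) M] [IsScalarTower A (DiffOp δ) M]

theorem augAdd_tmul (P : DiffOp δ) (m : M) :
    augAdd δ M (RightDiffOp.of δ P ⊗ₜ m) = P • m := rfl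

theorem augAdd_rightAct (k : Fin n) (x : Induced δ M) : augAdd δ M (rightAct δ M k x) = 0 := by
  induction x using TensorProduct.induction_on with
  | zero => simp
  | tmul P m =>
    rw [show P = RightDiffOp.of δ P.op from rfl, rightAct_tmul, map_sub, augAdd_tmul,
      augAdd_tmul, mul_smul, sub_self]
  | add x y hx hy => rw [map_add, map_add, hx, hy, add_zero]

theorem spencerZero_tmul (x : Induced δ M) (f : Fin 0 → Tan n A) :
    spencerZero δ M (x ⊗ₜ exteriorPower.ιMulti A 0 f) = x := by
  simp [spencerZero, exteriorPower.zeroEquiv_ιMulti]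

theorem spencerZero_injective : Function.Injective (spencerZero δ M) :=
  ((LinearEquiv.lTensor (Induced δ M) (exteriorPower.zeroEquiv (R := A) (M := Tan n A))).trans
    (TensorProduct.rid A (Induced δ M))).injective

/-- In lowest degree `d*` sends `x ⊗ dₖ` to `x dₖ`, so its image consists of the sums of the `x dₖ`.
-/
theorem spencerAdd_zero (x : Induced δ M) (k : Fin n) :
    spencerAdd δ M 0 (x ⊗ₜ wedge 0 (frame n A k) (exteriorPower.ιMulti A 0 ![])) =
      rightAct δ M k x ⊗ₜ exteriorPower.ιMulti A 0 ![] := by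
  have hc : exteriorPower.ιMulti A 0 (M := Tan n A) ![] ∈ constMul (frame n A) 0 := by
    convert! ιMulti_mem_constMul (b := frame n A) (A := A) (![] : Fin 0 → Fin n)
  rw [spencerAdd_constMul _ _ _ _ (wedge_mem_constMul k hc),
    Finset.sum_eq_single k (fun j _ hj => ?_) (by simp)]
  · rw [contract_wedge_zero, coframe_frame, if_pos rfl, one_smul]
  · rw [contract_wedge_zero, coframe_frame, if_neg hj.symm, zero_smul, TensorProduct.tmul_zero]

theorem spencerAug_mk (P : DiffOp δ) (m : M) (f : Fin 0 → Tan n A) :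
    spencerAug δ M (Spencer.mk δ P m (exteriorPower.ιMulti A 0 f)) = P • m := by
  change augAdd δ M (spencerZero δ M ((RightDiffOp.of δ P ⊗ₜ m) ⊗ₜ
    exteriorPower.ιMulti A 0 f)) = _
  rw [spencerZero_tmul, augAdd_tmul]

theorem spencerAug_surjective : Function.Surjective (spencerAug δ M) := fun m =>
  ⟨Spencer.mk δ 1 m (exteriorPower.ιMulti A 0 ![]), by rw [spencerAug_mk, one_smul]⟩

theorem augAdd_spencerZero_spencerAdd (y : Induced δ M ⊗[A] ⋀[A]^1 (Tan n A)) :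
    augAdd δ M (spencerZero δ M (spencerAdd δ M 0 y)) = 0 := by
  have hy := mem_avoiding_empty δ M 1 y
  induction hy using AddSubgroup.closure_induction with
  | mem y h =>
    obtain ⟨x, f, -, rfl⟩ := h
    have h1 : exteriorPower.ιMulti A 1 (frame n A ∘ f) =
        wedge 0 (frame n A (f 0)) (exteriorPower.ιMulti A 0 ![]) := by
      rw [wedge_ιMulti]
      congr 1
      ext i
      rw [Subsingleton.elim i 0]
      rfl
    rw [h1, spencerAdd_zero, spencerZero_tmul, augAdd_rightAct]
  | zero => simp
  | add x y _ _ hx hy => rw [map_add, map_add, map_add, hx, hy, add_zero]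
  | neg x _ hx => rw [map_neg, map_neg, map_neg, hx, neg_zero]

theorem exact_spencerD_spencerAug : Function.Exact (spencerD δ M 0) (spencerAug δ M) := fun y => by
  constructor
  · intro hy
    -- An element of the kernel of the augmentation is congruent to `1 ⊗ 0`, hence is a sum `∑ₖ zₖ
    -- dₖ`, the boundary of `∑ₖ zₖ ⊗ dₖ`.
    obtain ⟨z, hz⟩ := exists_eq_one_tmul_add δ M (spencerZero δ M y)
    rw [show augAdd δ M (spencerZero δ M y) = 0 from hy, TensorProduct.tmul_zero, zero_add] at hz
    refine ⟨(∑ k, z k ⊗ₜ wedge 0 (frame n A k) (exteriorPower.ιMulti A 0 ![]) :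
      Induced δ M ⊗[A] ⋀[A]^1 (Tan n A)), spencerZero_injective δ M ?_⟩
    change spencerZero δ M (spencerAdd δ M 0 _) = spencerZero δ M y
    rw [hz, map_sum, map_sum]
    exact Finset.sum_congr rfl fun k _ => by rw [spencerAdd_zero, spencerZero_tmul]
  · rintro ⟨z, rfl⟩
    exact augAdd_spencerZero_spencerAdd δ M z

theorem exact_spencerD_spencerD (r : ℕ) :
    Function.Exact (spencerD δ M (r + 1)) (spencerD δ M r) := fun y => by
  constructor
  · intro hy
    exact exists_spencerAdd_eq (rightDiv_rightAct δ M) (rightDiv_rightAct_of_ne δ M) r hy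
  · rintro ⟨z, rfl⟩
    exact spencerAdd_spencerAdd δ M r z

theorem subsingleton_spencer {r : ℕ} (h : n < r) : Subsingleton (Spencer δ M r) := by
  have := subsingleton_exteriorPower (frame n A) (s := r) (by simpa using h)
  exact inferInstanceAs (Subsingleton (Induced δ M ⊗[A] ⋀[A]^r (Tan n A)))

end SpencerResolution

/-! ### The Spencer differential on arbitrary vector fields -/

section Bracket

variable {n : ℕ} {A : Type u} [CommRing A] (δ : CommutingDerivations n A)

/-- The derivative `ξ(v)` of the components of a vector field `v` along `ξ`. -/
def vecDer (ξ v : Tan n A) : Tan n A := fun l => ∑ k, ξ k * δ.der k (v l)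

theorem bracket_eq (ξ η : Tan n A) : bracket δ ξ η = vecDer δ ξ η - vecDer δ η ξ := rfl

theorem coeffDer_frame (k : Fin n) (v : Tan n A) :
    coeffDer (frame n A) (δ.der k) v = fun l => δ.der k (v l) := by
  funext l
  simp [coeffDer, frame, Finset.sum_apply, Pi.single_apply]

theorem sum_smul_coeffDer_frame (ξ v : Tan n A) :
    ∑ k, ξ k • coeffDer (frame n A) (δ.der k) v = vecDer δ ξ v := by
  funext l
  simp [coeffDer_frame, vecDer, Finset.sum_apply]

theorem sum_smul_multivecDer (r : ℕ) (ξ : Tan n A) (w : Fin (r + 1) → Tan n A) :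
    ∑ k, ξ k • multivecDer δ (r + 1) k (exteriorPower.ιMulti A (r + 1) w) =
      ∑ i : Fin (r + 1), (-1 : ℤ) ^ (i : ℕ) •
        wedge r (vecDer δ ξ (w i)) (exteriorPower.ιMulti A r (i.removeNth w)) := by
  simp only [multivecDer, coeffDer_ιMulti, Finset.smul_sum]
  rw [Finset.sum_comm]
  refine Finset.sum_congr rfl fun i _ => ?_
  rw [← sum_smul_coeffDer_frame]
  change _ = (-1 : ℤ) ^ (i : ℕ) • wedgeLin A r (∑ k, ξ k • coeffDer (frame n A) (δ.der k) (w i)) _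
  simp only [map_sum, map_smul, LinearMap.sum_apply, LinearMap.smul_apply, Finset.smul_sum]
  exact Finset.sum_congr rfl fun k _ => smul_comm _ _ _

theorem wedge_sub_left {E : Type u} [AddCommGroup E] [Module A E] (s : ℕ) (v w : E)
    (θ : ⋀[A]^s E) : wedge s (v - w) θ = wedge s v θ - wedge s w θ :=
  DFunLike.congr_fun (map_sub (wedgeLin A s) v w) θ

/-- Each pair of positions is met twice: the earlier field differentiates the later one, and
conversely. The signs are opposite, since the removal of the earlier field shifts the position of
the later one by one. The difference of the two derivatives is the bracket. -/
theorem sum_sum_smul_multivecDer (r : ℕ) (ξ : Fin (r + 2) → Tan n A) :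
    ∑ j : Fin (r + 2), (-1 : ℤ) ^ (j : ℕ) • ∑ k, ξ j k •
        multivecDer δ (r + 1) k (exteriorPower.ιMulti A (r + 1) (j.removeNth ξ)) =
      -∑ j : Fin (r + 2), ∑ i : Fin (r + 1), if i.castSucc < j then
        (-1 : ℤ) ^ ((i : ℕ) + (j : ℕ)) • exteriorPower.ιMulti A (r + 1)
          (Matrix.vecCons (bracket δ (ξ i.castSucc) (ξ j)) (i.removeNth (j.removeNth ξ)))
        else 0 := by
  simp only [sum_smul_multivecDer, Finset.smul_sum]
  -- Both double sums are folded onto `i ≤ j`, where the pair of positions is `i.castSucc < j.succ`;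
  -- the condition in the bracket sum then selects one of the two folded terms.
  rw [Fin.sum_sum_eq_sum_triangle_add, Fin.sum_sum_eq_sum_triangle_add,
    ← Finset.sum_neg_distrib]
  refine Finset.sum_congr rfl fun i _ => ?_
  rw [← Finset.sum_neg_distrib]
  refine Finset.sum_congr rfl fun j hj => ?_
  rw [Finset.mem_Ici] at hj
  have h1 : i.castSucc.removeNth ξ j = ξ j.succ := by
    simp [Fin.removeNth_apply, Fin.succAbove_of_le_castSucc, hj]
  have h2 : j.succ.removeNth ξ i = ξ i.castSucc := by
    simp [Fin.removeNth_apply, Fin.succAbove_of_castSucc_lt, hj]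
  have h3 : j.removeNth (i.castSucc.removeNth ξ) = i.removeNth (j.succ.removeNth ξ) := by
    rw [Fin.removeNth_removeNth_eq_swap]
    simp [Fin.predAbove, not_lt.2 hj, Fin.succAbove]
  rw [if_neg (by simpa using hj), if_pos (by simpa [Fin.lt_def] using Nat.lt_succ_of_le hj),
    zero_add, h1, h2, h3, ← wedge_ιMulti, bracket_eq, wedge_sub_left, smul_smul, smul_smul,
    Fin.val_castSucc, Fin.val_succ]
  have e1 : (-1 : ℤ) ^ (j + 1 : ℕ) * (-1) ^ (i : ℕ) = -((-1) ^ (i : ℕ) * (-1) ^ (j : ℕ)) := by ring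
  have e2 : (-1 : ℤ) ^ (i + (j + 1) : ℕ) = -((-1) ^ (i : ℕ) * (-1) ^ (j : ℕ)) := by ring
  rw [e1, e2]
  generalize (-1 : ℤ) ^ (i : ℕ) * (-1) ^ (j : ℕ) = c
  rw [neg_smul, neg_smul, neg_neg, smul_sub, sub_eq_add_neg]

variable (M : Type v) [AddCommGroup M] [Module A M] [Module (DiffOp δ) M]
  [IsScalarTower A (DiffOp δ) M]

/-- The right action `x ↦ x ξ` of a vector field on `D ⊗_A M`. -/
noncomputable def rightVec (ξ : Tan n A) (x : Induced δ M) : Induced δ M :=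
  ∑ k, rightAct δ M k (ξ k • x)

/-- The coefficient acts before `dₖ`, so that `P` is multiplied by `ξᵏ dₖ` in this order; in the
second term `ξᵏ` moves across the tensor product onto `dₖ m`. -/
theorem rightVec_tmul (ξ : Tan n A) (P : DiffOp δ) (m : M) :
    rightVec δ M ξ (RightDiffOp.of δ P ⊗ₜ m) =
      RightDiffOp.of δ (P * DiffOp.ofVec δ ξ) ⊗ₜ m
        - RightDiffOp.of δ P ⊗ₜ (DiffOp.ofVec δ ξ • m) := by
  have h1 : RightDiffOp.of δ (P * DiffOp.ofVec δ ξ) =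
      ∑ k, RightDiffOp.of δ (P * DiffOp.ofA δ (ξ k) * DiffOp.d δ k) := by
    simp only [mul_assoc]
    exact Finset.mul_sum Finset.univ (fun k => DiffOp.ofA δ (ξ k) * DiffOp.d δ k) P
  simp only [rightVec, TensorProduct.smul_tmul', RightDiffOp.smul_of, rightAct_tmul,
    Finset.sum_sub_distrib, h1, TensorProduct.sum_tmul]
  congr 1
  rw [DiffOp.ofVec, Finset.sum_smul, TensorProduct.tmul_sum]
  refine Finset.sum_congr rfl fun k _ => ?_
  rw [mul_smul, ofA_smul, TensorProduct.tmul_smul (ξ k), TensorProduct.smul_tmul',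
    RightDiffOp.smul_of]

theorem coframe_apply (k : Fin n) (v : Tan n A) : coframe n A k v = v k := by
  simp [coframe, frame]

theorem multivecDer_contract (r : ℕ) (j k : Fin n) (θ : ⋀[A]^(r + 1) (Tan n A)) :
    contract r (coframe n A j) (multivecDer δ (r + 1) k θ) =
      multivecDer δ r k (contract r (coframe n A j) θ) :=
  (coeffDer_contract (δ.der k) (coframe_frame_int j) θ).symm

/-- The divergence terms `∂ₖ ξⱼᵏ` arise on both sides and agree: on the left from differentiating
the contraction of the product, on the right from `(a x) dₖ = a (x dₖ) - (∂ₖ a) x`. -/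
theorem spencerAdd_ιMulti (r : ℕ) (x : Induced δ M) (ξ : Fin (r + 1) → Tan n A) :
    spencerAdd δ M r (x ⊗ₜ exteriorPower.ιMulti A (r + 1) ξ) =
      ∑ j : Fin (r + 1), rightVec δ M (ξ j) x ⊗ₜ
        ((-1 : ℤ) ^ (j : ℕ) • exteriorPower.ιMulti A r (j.removeNth ξ)) -
      x ⊗ₜ ∑ j : Fin (r + 1), (-1 : ℤ) ^ (j : ℕ) • ∑ k, ξ j k •
        multivecDer δ r k (exteriorPower.ιMulti A r (j.removeNth ξ)) := by
  rw [spencerAdd_tmul, TensorProduct.tmul_sum, ← Finset.sum_sub_distrib]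
  simp only [multivecDer_contract, contract_ιMulti, map_sum, map_zsmul, coframe_apply,
    TensorProduct.tmul_sum, ← Finset.sum_sub_distrib]
  rw [Finset.sum_comm]
  refine Finset.sum_congr rfl fun j _ => ?_
  simp only [rightVec, TensorProduct.sum_tmul, Finset.smul_sum, TensorProduct.tmul_sum]
  rw [← Finset.sum_sub_distrib]
  refine Finset.sum_congr rfl fun k _ => ?_
  simp only [multivecDer, coeffDer_smul, rightAct_smul, TensorProduct.sub_tmul,
    TensorProduct.smul_tmul, TensorProduct.tmul_add, smul_add, smul_comm ((-1 : ℤ) ^ (j : ℕ))]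
  abel

theorem spencerD_mk_one (P : DiffOp δ) (m : M) (ξ : Tan n A) :
    spencerD δ M 0 (Spencer.mk δ P m (exteriorPower.ιMulti A 1 ![ξ])) =
      Spencer.mk δ (P * DiffOp.ofVec δ ξ) m (exteriorPower.ιMulti A 0 ![]) -
        Spencer.mk δ P (DiffOp.ofVec δ ξ • m) (exteriorPower.ιMulti A 0 ![]) := by
  have hc : exteriorPower.ιMulti A 0 (M := Tan n A) ![] ∈ constMul (frame n A) 0 := by
    convert! ιMulti_mem_constMul (b := frame n A) (A := A) (![] : Fin 0 → Fin n)
  have h := spencerAdd_ιMulti δ M 0 (RightDiffOp.of δ P ⊗ₜ m) ![ξ]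
  have h0 : Fin.removeNth 0 ![ξ] = ![] := Subsingleton.elim _ _
  simp only [Fin.sum_univ_succ, Fin.sum_univ_zero, add_zero, h0, Fin.val_zero, pow_zero,
    one_smul, multivecDer, coeffDer_constMul _ hc, smul_zero, Finset.sum_const_zero,
    TensorProduct.tmul_zero, sub_zero, rightVec_tmul, Matrix.cons_val_zero,
    TensorProduct.sub_tmul] at h
  exact h

theorem Spencer.tmul_zsmul {r : ℕ} (c : ℤ) (x : Induced δ M) (θ : ⋀[A]^r (Tan n A)) :
    Spencer.tmul δ x (c • θ) = c • Spencer.tmul δ x θ :=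
  map_zsmul (TensorProduct.mk A (Induced δ M) (⋀[A]^r (Tan n A)) x) c θ

theorem spencerD_mk (r : ℕ) (P : DiffOp δ) (m : M) (ξ : Fin (r + 2) → Tan n A) :
    spencerD δ M (r + 1) (Spencer.mk δ P m (exteriorPower.ιMulti A (r + 2) ξ)) =
      ∑ j : Fin (r + 2), (-1 : ℤ) ^ (j : ℕ) •
        (Spencer.mk δ (P * DiffOp.ofVec δ (ξ j)) m
            (exteriorPower.ιMulti A (r + 1) (j.removeNth ξ)) -
          Spencer.mk δ P (DiffOp.ofVec δ (ξ j) • m)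
            (exteriorPower.ιMulti A (r + 1) (j.removeNth ξ))) +
      ∑ j : Fin (r + 2), ∑ i : Fin (r + 1), if i.castSucc < j then
        (-1 : ℤ) ^ ((i : ℕ) + (j : ℕ)) •
          Spencer.mk δ P m (exteriorPower.ιMulti A (r + 1)
            (Matrix.vecCons (bracket δ (ξ i.castSucc) (ξ j)) (i.removeNth (j.removeNth ξ))))
      else 0 := by
  refine (spencerAdd_ιMulti δ M (r + 1) (RightDiffOp.of δ P ⊗ₜ m) ξ).trans ?_
  rw [sum_sum_smul_multivecDer, TensorProduct.tmul_neg, sub_neg_eq_add]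
  simp only [rightVec_tmul, TensorProduct.sub_tmul, TensorProduct.tmul_sum]
  congr 1
  · refine Finset.sum_congr rfl fun j _ => ?_
    rw [smul_sub]
    exact congrArg₂ (fun x y : Spencer δ M (r + 1) => x - y)
      (Spencer.tmul_zsmul δ M _ _ _) (Spencer.tmul_zsmul δ M _ _ _)
  · refine Finset.sum_congr rfl fun j _ => Finset.sum_congr rfl fun i _ => ?_
    split_ifs
    · exact Spencer.tmul_zsmul δ M _ _ _
    · exact TensorProduct.tmul_zero _ _

end Bracket

/-! ### Duality between forms and multivectors -/

section Pairing

variable {A : Type u} [CommRing A]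

/-- On decomposable elements this is the Laplace expansion of the determinant along the column of
`φ`. -/
theorem pairingDual_wedge {E : Type u} [AddCommGroup E] [Module A E] (s : ℕ)
    (φ : Module.Dual A E) (ω : ⋀[A]^s (Module.Dual A E)) (θ : ⋀[A]^(s + 1) E) :
    exteriorPower.pairingDual A E (s + 1) (wedge s φ ω) θ =
      exteriorPower.pairingDual A E s ω (contract s φ θ) := by
  induction ω using exteriorPower_induction with
  | smul_ι a f =>
    induction θ using exteriorPower_induction with
    | smul_ι c v =>
      have key : exteriorPower.pairingDual A E (s + 1) (wedge s φ (exteriorPower.ιMulti A s f))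
          (exteriorPower.ιMulti A (s + 1) v) = exteriorPower.pairingDual A E s
            (exteriorPower.ιMulti A s f) (contract s φ (exteriorPower.ιMulti A (s + 1) v)) := by
        rw [wedge_ιMulti, contract_ιMulti, map_sum, exteriorPower.pairingDual_ιMulti_ιMulti,
          Matrix.det_succ_column_zero]
        refine Finset.sum_congr rfl fun i _ => ?_
        rw [map_zsmul, map_smul, exteriorPower.pairingDual_ιMulti_ιMulti, zsmul_eq_mul,
          smul_eq_mul, ← mul_assoc]
        push_cast
        rfl
      simp only [map_smul, LinearMap.smul_apply, key]
    | add x y hx hy => rw [map_add, map_add, map_add, hx, hy]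
  | add x y hx hy =>
    rw [map_add, map_add, map_add, LinearMap.add_apply, LinearMap.add_apply, hx, hy]

variable {n : ℕ}

theorem pairingDual_basis (s : ℕ) (I) (θ : ⋀[A]^s (Tan n A)) :
    exteriorPower.pairingDual A (Tan n A) s ((coframe n A).exteriorPower s I) θ =
      ((frame n A).exteriorPower s).repr θ I := by
  rw [exteriorPower.basis_repr_apply, exteriorPower.ιMultiDual, exteriorPower.basis_apply]
  have h : ⇑(coframe n A) = (frame n A).coord := (frame n A).coe_dualBasis
  rw [h]

theorem pairingDual_constMul {s : ℕ} {ω : ⋀[A]^s (Cot n A)} (hω : ω ∈ constMul (coframe n A) s)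
    {θ : ⋀[A]^s (Tan n A)} (hθ : θ ∈ constMul (frame n A) s) :
    ∃ c : ℤ, exteriorPower.pairingDual A (Tan n A) s ω θ = c := by
  choose a ha using repr_constMul hω
  choose b hb using repr_constMul hθ
  refine ⟨∑ I, a I * b I, ?_⟩
  rw [← ((coframe n A).exteriorPower s).sum_repr ω]
  simp only [map_sum, map_smul, LinearMap.sum_apply, LinearMap.smul_apply, smul_eq_mul,
    pairingDual_basis, ha, hb, Int.cast_sum, Int.cast_mul]

/-- The isomorphism of `∧ˢ T*` with the dual of `∧ˢ T` given by the pairing. -/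
noncomputable def pairingEquiv (n : ℕ) (A : Type u) [CommRing A] (s : ℕ) :
    ⋀[A]^s (Cot n A) ≃ₗ[A] Module.Dual A (⋀[A]^s (Tan n A)) :=
  ((coframe n A).exteriorPower s).equiv ((frame n A).exteriorPower s).dualBasis (Equiv.refl _)

/-- The determinant pairing takes the basis of products of the `dxⁱ` to the coordinate forms of the
products of the `dᵢ`, so it is the isomorphism matching these bases. -/
theorem pairingEquiv_apply (s : ℕ) (ω : ⋀[A]^s (Cot n A)) :
    pairingEquiv n A s ω = exteriorPower.pairingDual A (Tan n A) s ω := by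
  have h : (pairingEquiv n A s).toLinearMap = exteriorPower.pairingDual A (Tan n A) s := by
    refine ((coframe n A).exteriorPower s).ext fun I => LinearMap.ext fun θ => ?_
    rw [pairingDual_basis, pairingEquiv, LinearEquiv.coe_coe, Basis.equiv_apply,
      Equiv.refl_apply, Basis.coe_dualBasis, Basis.coord_apply]
  exact DFunLike.congr_fun h ω

/-- The isomorphism `∧ˢ T* ⊗ N ≅ hom_A(∧ˢ T, N)`. -/
noncomputable def formsHomEquiv (n : ℕ) {A : Type u} [CommRing A] (N : Type v) [AddCommGroup N]
    [Module A N] (s : ℕ) :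
    ⋀[A]^s (Cot n A) ⊗[A] N ≃ₗ[A] (⋀[A]^s (Tan n A) →ₗ[A] N) :=
  (LinearEquiv.rTensor N (pairingEquiv n A s)).trans
    (dualTensorHomEquivOfBasis ((frame n A).exteriorPower s))

theorem formsHomEquiv_tmul (N : Type v) [AddCommGroup N] [Module A N] (s : ℕ)
    (ω : ⋀[A]^s (Cot n A)) (f : N) (θ : ⋀[A]^s (Tan n A)) :
    formsHomEquiv n N s (ω ⊗ₜ f) θ = exteriorPower.pairingDual A (Tan n A) s ω θ • f := by
  rw [formsHomEquiv, LinearEquiv.trans_apply, LinearEquiv.rTensor_tmul,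
    dualTensorHomEquivOfBasis_apply, dualTensorHom_apply, pairingEquiv_apply]

end Pairing

/-! ### The tensor-hom adjunction over `D` -/

section Adjunction

variable {n : ℕ} {A : Type u} [CommRing A] (δ : CommutingDerivations n A)
  (X : Type w) [AddCommGroup X] [Module A X] [Module (DiffOp δ) X] [IsScalarTower A (DiffOp δ) X]
  (M : Type v) [AddCommGroup M] [Module A M] [Module (DiffOp δ) M] [IsScalarTower A (DiffOp δ) M]

/-- The adjoint `x ↦ (m ↦ F (x ⊗ m))` of `F`. -/
noncomputable def curryD (F : TensorA A X M →ₗ[DiffOp δ] A) : X →ₗ[DiffOp δ] InvSystem A M :=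
  dLinear δ (X := X) (Y := HomA A M A)
    (TensorProduct.curry (F.restrictScalars A : X ⊗[A] M →ₗ[A] A) : X →ₗ[A] M →ₗ[A] A)
    (fun i x => DFunLike.ext _ _ fun m => by
      rw [HomA.d_smul_apply]
      change F (TensorA.tmul A (DiffOp.d δ i • x) m) =
        DiffOp.d δ i • F (TensorA.tmul A x m) - F (TensorA.tmul A x (DiffOp.d δ i • m))
      -- `D`-linearity of `F` and the Leibniz rule on `x ⊗ m` turn the right-hand side into `F (dᵢ x
      -- ⊗ m)`.
      rw [← map_smul, TensorA.d_smul_tmul, map_add, add_sub_cancel_right])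

/-- The adjoint `x ⊗ m ↦ G x m` of `G`. -/
noncomputable def uncurryD (G : X →ₗ[DiffOp δ] InvSystem A M) : TensorA A X M →ₗ[DiffOp δ] A :=
  dLinear δ (X := TensorA A X M) (Y := A)
    (TensorProduct.lift (G.restrictScalars A : X →ₗ[A] M →ₗ[A] A) : X ⊗[A] M →ₗ[A] A)
    (fun i z => by
      induction z using TensorProduct.induction_on with
      | zero =>
        refine (congrArg _ (show DiffOp.d δ i • (0 : TensorA A X M) = 0 from smul_zero _)).trans ?_
        exact (map_zero _).trans (smul_zero (A := A) (DiffOp.d δ i)).symm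
      | tmul x m =>
        refine (congrArg _ (TensorA.d_smul_tmul δ X M i x m)).trans ((map_add _ _ _).trans ?_)
        change G (DiffOp.d δ i • x) m + G x (DiffOp.d δ i • m) = DiffOp.d δ i • G x m
        rw [map_smul, HomA.d_smul_apply, sub_add_cancel]
      | add x y hx hy =>
        refine (congrArg _ (smul_add (A := TensorA A X M) (DiffOp.d δ i) x y)).trans ((map_add _ _ _).trans ?_)
        refine (congrArg₂ _ hx hy).trans ((smul_add _ _ _).symm.trans ?_)
        exact congrArg _ (map_add _ _ _).symm)

/-- The adjunction `hom_D(X ⊗_A M, A) ≅ hom_D(X, hom_A(M, A))`. -/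
noncomputable def curryDEquiv :
    (TensorA A X M →ₗ[DiffOp δ] A) ≃+ (X →ₗ[DiffOp δ] InvSystem A M) where
  toFun := curryD δ X M
  invFun := uncurryD δ X M
  left_inv F := LinearMap.ext fun z => by
    induction z using TensorProduct.induction_on with
    | zero => exact (map_zero _).trans (map_zero F).symm
    | tmul x m => rfl
    | add x y hx hy =>
      exact (map_add _ _ _).trans ((congrArg₂ _ hx hy).trans (map_add F _ _).symm)
  right_inv G := rfl
  map_add' F F' := rfl

end Adjunction

/-! ### Homomorphisms from `SP(A)` and the de Rham complex -/

section SpencerHom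

variable {n : ℕ} {A : Type u} [CommRing A] (δ : CommutingDerivations n A)
  (N : Type v) [AddCommGroup N] [Module A N] [Module (DiffOp δ) N] [IsScalarTower A (DiffOp δ) N]

/-- The map `P ⊗ a ↦ P a f` from `D ⊗_A A` to `N`, for `f ∈ N`. -/
noncomputable def inducedEval (f : N) : Induced δ A →+ N :=
  TensorProduct.liftAddHom
    (AddMonoidHom.mk' (fun P => AddMonoidHom.mk' (fun a : A => P.op • a • f)
        (fun a a' => by rw [add_smul, smul_add]))
      (fun P P' => AddMonoidHom.ext fun a => add_smul P.op P'.op (a • f)))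
    (fun c P a => by
      change (P.op * DiffOp.ofA δ c) • a • f = P.op • (c • a) • f
      rw [mul_smul, ofA_smul, smul_assoc])

theorem inducedEval_tmul (f : N) (P : DiffOp δ) (a : A) :
    inducedEval δ N f (RightDiffOp.of δ P ⊗ₜ a) = P • a • f := rfl

theorem inducedEval_add (f g : N) (x : Induced δ A) :
    inducedEval δ N (f + g) x = inducedEval δ N f x + inducedEval δ N g x := by
  induction x using TensorProduct.induction_on with
  | zero => simp
  | tmul P a =>
    rw [show P = RightDiffOp.of δ P.op from rfl]
    simp only [inducedEval_tmul, smul_add]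
  | add x y hx hy => simp only [map_add, hx, hy]; abel

theorem inducedEval_smul (c : A) (f : N) (x : Induced δ A) :
    inducedEval δ N f (c • x) = inducedEval δ N (c • f) x := by
  induction x using TensorProduct.induction_on with
  | zero => simp
  | tmul P a =>
    rw [TensorProduct.smul_tmul', TensorProduct.smul_tmul, show P = RightDiffOp.of δ P.op from rfl,
      inducedEval_tmul, inducedEval_tmul, smul_assoc, smul_comm c a f]
  | add x y hx hy => simp only [map_add, smul_add, hx, hy]

theorem inducedEval_left (Q : DiffOp δ) (f : N) (x : Induced δ A) :
    inducedEval δ N f (Q • x) = Q • inducedEval δ N f x := by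
  induction x using TensorProduct.induction_on with
  | zero => simp
  | tmul P a => exact mul_smul Q P.op (a • f)
  | add x y hx hy => simp only [map_add, smul_add, hx, hy]

variable {N}

/-- The additive map `P ⊗ a ⊗ θ ↦ P a g(θ)`. -/
noncomputable def spencerLiftAdd (r : ℕ) (g : ⋀[A]^r (Tan n A) →ₗ[A] N) :
    Induced δ A ⊗[A] ⋀[A]^r (Tan n A) →+ N :=
  TensorProduct.liftAddHom
    (AddMonoidHom.mk' (fun x => AddMonoidHom.mk' (fun θ => inducedEval δ N (g θ) x)
        (fun θ θ' => by rw [map_add, inducedEval_add]))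
      (fun x x' => AddMonoidHom.ext fun θ => map_add (inducedEval δ N (g θ)) x x'))
    (fun c x θ => by
      simp only [AddMonoidHom.mk'_apply, map_smul, inducedEval_smul])

/-- The `D`-linear map `P ⊗ a ⊗ θ ↦ P a g(θ)`. -/
noncomputable def spencerLift (r : ℕ) (g : ⋀[A]^r (Tan n A) →ₗ[A] N) :
    Spencer δ A r →ₗ[DiffOp δ] N where
  toFun := spencerLiftAdd δ r g
  map_add' := map_add (spencerLiftAdd δ r g)
  map_smul' Q x := by
    refine TensorProduct.induction_on
      (motive := fun x => spencerLiftAdd δ r g (Q • x) = Q • spencerLiftAdd δ r g x) x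
      (by rw [smul_zero, map_zero, smul_zero])
      (fun x θ => by
        rw [TensorProduct.smul_tmul']
        exact inducedEval_left δ N Q (g θ) x)
      (fun x y hx hy => by rw [smul_add, map_add, hx, hy, map_add, smul_add])

theorem spencerLift_mk (r : ℕ) (g : ⋀[A]^r (Tan n A) →ₗ[A] N) (θ : ⋀[A]^r (Tan n A)) :
    spencerLift δ r g (Spencer.mk δ 1 1 θ) = g θ := by
  change (1 : DiffOp δ) • (1 : A) • g θ = g θ
  rw [one_smul, one_smul]

theorem Spencer.mk_add (r : ℕ) (θ θ' : ⋀[A]^r (Tan n A)) :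
    Spencer.mk δ (1 : DiffOp δ) (1 : A) (θ + θ') = Spencer.mk δ 1 1 θ + Spencer.mk δ 1 1 θ' :=
  TensorProduct.tmul_add _ _ _

/-- Since `P ⊗ a = P a ⊗ 1`, the elements `1 ⊗ 1 ⊗ θ` generate over `D`, and a `D`-linear map is
determined by its values on them. -/
theorem Spencer.mk_eq_smul (r : ℕ) (P : DiffOp δ) (a : A) (θ : ⋀[A]^r (Tan n A)) :
    Spencer.mk δ P a θ = P • a • Spencer.mk δ 1 1 θ := by
  have h1 : (RightDiffOp.of δ P ⊗ₜ[A] a : Induced δ A) =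
      RightDiffOp.of δ (P * (DiffOp.ofA δ a * 1)) ⊗ₜ[A] (1 : A) := by
    conv_lhs => rw [← mul_one a, ← smul_eq_mul, ← TensorProduct.smul_tmul, RightDiffOp.smul_of]
    rw [mul_one]
  exact congrArg (fun x => Spencer.tmul δ x θ) h1

theorem Spencer.mk_smul (r : ℕ) (a : A) (θ : ⋀[A]^r (Tan n A)) :
    Spencer.mk δ (1 : DiffOp δ) (1 : A) (a • θ) = a • Spencer.mk δ 1 1 θ := by
  have h : Spencer.mk δ (1 : DiffOp δ) (1 : A) (a • θ) = Spencer.mk δ 1 a θ := by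
    refine (TensorProduct.smul_tmul a _ θ).symm.trans ?_
    rw [TensorProduct.smul_tmul', TensorProduct.smul_tmul, smul_eq_mul, mul_one]
    rfl
  rw [h, Spencer.mk_eq_smul, one_smul]

theorem spencer_hom_ext {r : ℕ} {G H : Spencer δ A r →ₗ[DiffOp δ] N}
    (h : ∀ θ, G (Spencer.mk δ 1 1 θ) = H (Spencer.mk δ 1 1 θ)) : G = H := by
  refine LinearMap.ext fun x => ?_
  refine TensorProduct.induction_on (motive := fun x => G x = H x) x
    ((map_zero G).trans (map_zero H).symm) (fun y θ => ?_)
    (fun x y hx hy => (map_add G x y).trans ((congrArg₂ _ hx hy).trans (map_add H x y).symm))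
  refine TensorProduct.induction_on
    (motive := fun y => G (Spencer.tmul δ y θ) = H (Spencer.tmul δ y θ)) y ?_ (fun P a => ?_)
    (fun x y hx hy => ?_)
  · have h0 : Spencer.tmul δ (0 : Induced δ A) θ = 0 := TensorProduct.zero_tmul _ _
    rw [h0, map_zero, map_zero]
  · change G (Spencer.mk δ P.op a θ) = H (Spencer.mk δ P.op a θ)
    rw [Spencer.mk_eq_smul, ← Spencer.mk_smul, map_smul, map_smul, h]
  · have hxy : Spencer.tmul δ (x + y) θ = Spencer.tmul δ x θ + Spencer.tmul δ y θ :=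
      TensorProduct.add_tmul _ _ _
    rw [hxy, map_add, map_add, hx, hy]

variable (N)

/-- The isomorphism `hom_D(D ⊗_A A ⊗_A ∧ʳ T, N) ≅ hom_A(∧ʳ T, N)`. -/
noncomputable def spencerHomEquiv (r : ℕ) :
    (Spencer δ A r →ₗ[DiffOp δ] N) ≃+ (⋀[A]^r (Tan n A) →ₗ[A] N) where
  toFun G :=
    { toFun := fun θ => G (Spencer.mk δ 1 1 θ)
      map_add' := fun θ θ' => by rw [Spencer.mk_add, map_add]
      map_smul' := fun a θ => by
        rw [Spencer.mk_smul, ← ofA_smul δ a (Spencer.mk δ 1 1 θ), map_smul, ofA_smul,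
          RingHom.id_apply] }
  invFun := spencerLift δ r
  left_inv G := spencer_hom_ext δ fun θ => spencerLift_mk δ r _ θ
  right_inv g := LinearMap.ext fun θ => spencerLift_mk δ r g θ
  map_add' G H := rfl

theorem spencerHomEquiv_apply (r : ℕ) (G : Spencer δ A r →ₗ[DiffOp δ] N)
    (θ : ⋀[A]^r (Tan n A)) : spencerHomEquiv δ N r G θ = G (Spencer.mk δ 1 1 θ) := rfl

/-- The isomorphism `hom_D(SP(A), N) ≅ DR(N)` in degree `r`. -/
noncomputable def spencerDeRhamEquiv (r : ℕ) :
    (Spencer δ A r →ₗ[DiffOp δ] N) ≃+ ⋀[A]^r (Cot n A) ⊗[A] N :=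
  (spencerHomEquiv δ N r).trans (formsHomEquiv n N r).symm.toAddEquiv

theorem spencerDeRhamEquiv_symm_mk (r : ℕ) (y : ⋀[A]^r (Cot n A) ⊗[A] N)
    (θ : ⋀[A]^r (Tan n A)) :
    (spencerDeRhamEquiv δ N r).symm y (Spencer.mk δ 1 1 θ) = formsHomEquiv n N r y θ :=
  spencerLift_mk δ r _ θ

/-- Because `∂ₖ 1 = 0`, the right and left actions of `dₖ` agree on `1 ⊗ 1`. This is how the left
operators `dₖ` of `∇` emerge from `d*`. -/
theorem rightAct_one (k : Fin n) :
    rightAct δ A k (RightDiffOp.of δ 1 ⊗ₜ 1) = RightDiffOp.of δ (DiffOp.d δ k) ⊗ₜ 1 := by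
  rw [rightAct_tmul, d_smul_ring, Derivation.map_one_eq_zero, TensorProduct.tmul_zero, sub_zero,
    one_mul]

theorem spencerD_mk_constMul (r : ℕ) {θ : ⋀[A]^(r + 1) (Tan n A)}
    (h : θ ∈ constMul (frame n A) (r + 1)) :
    spencerD δ A r (Spencer.mk δ 1 1 θ) =
      ∑ k, DiffOp.d δ k • Spencer.mk δ 1 1 (contract r (coframe n A k) θ) := by
  refine (spencerAdd_constMul δ A r _ h).trans (Finset.sum_congr rfl fun k _ => ?_)
  rw [rightAct_one]
  refine (Spencer.mk_eq_smul δ r (DiffOp.d δ k) 1 _).trans ?_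
  rw [one_smul]

-- Both sides are compared on constant `ω` and basis elements `θ`. There the two differentials are
-- of Koszul type, and the pairing exchanges `dxᵏ ∧` with contraction by `dxᵏ`.
set_option synthInstance.maxHeartbeats 200000 in
theorem spencerDeRhamEquiv_symm_nabla (r : ℕ) (y : ⋀[A]^r (Cot n A) ⊗[A] N) :
    (spencerDeRhamEquiv δ N (r + 1)).symm (nabla δ N r y) =
      (spencerDeRhamEquiv δ N r).symm y ∘ₗ spencerD δ A r := by
  refine constMul_tmul_induction (b := coframe n A)
    (p := fun y => (spencerDeRhamEquiv δ N (r + 1)).symm (nabla δ N r y) =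
      (spencerDeRhamEquiv δ N r).symm y ∘ₗ spencerD δ A r) (fun ω hω f => ?_)
    (fun x y hx hy => by rw [map_add, map_add, map_add, hx, hy, LinearMap.add_comp]) y
  apply (spencerHomEquiv δ N (r + 1)).injective
  refine ((frame n A).exteriorPower (r + 1)).ext fun I => ?_
  have hθ := basis_mem_constMul (A := A) (b := frame n A) (s := r + 1) I
  generalize (frame n A).exteriorPower (r + 1) I = θ at hθ
  rw [spencerHomEquiv_apply, spencerHomEquiv_apply, spencerDeRhamEquiv_symm_mk,
    nabla_constMul δ N r hω, LinearMap.comp_apply, spencerD_mk_constMul δ r hθ, map_sum, map_sum,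
    LinearMap.sum_apply]
  refine Finset.sum_congr rfl fun k _ => ?_
  -- The pairing of constant elements is an integer, so `dₖ` passes across it without a derivative
  -- term.
  obtain ⟨c, hc⟩ := pairingDual_constMul hω (contract_mem_constMul (coframe_frame_int k) hθ)
  rw [map_smul, spencerDeRhamEquiv_symm_mk, formsHomEquiv_tmul, formsHomEquiv_tmul,
    pairingDual_wedge, hc, d_smul_smul, Derivation.map_intCast, zero_smul, add_zero]

theorem spencerDeRhamEquiv_comp (r : ℕ) (G : Spencer δ A r →ₗ[DiffOp δ] N) :
    spencerDeRhamEquiv δ N (r + 1) (G ∘ₗ spencerD δ A r) =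
      nabla δ N r (spencerDeRhamEquiv δ N r G) := by
  rw [← AddEquiv.eq_symm_apply, spencerDeRhamEquiv_symm_nabla, AddEquiv.symm_apply_apply]

end SpencerHom

end DiffMod

theorem corollary3p16 {n : ℕ} {A : Type*} [CommRing A] (δ : CommutingDerivations n A)
    (M : Type*) [AddCommGroup M] [Module A M] [Module (DiffOp δ) M]
    [IsScalarTower A (DiffOp δ) M] :
    -- the de Rham complex `DR(M)`
    ((∀ s (ω : ⋀[A]^s (Cot n A)) (m : M),
        nabla δ M s (ω ⊗ₜ[A] m) = extDer δ s ω ⊗ₜ[A] m +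
          ∑ i, wedge s (coframe n A i) ω ⊗ₜ[A] (DiffOp.d δ i • m)) ∧
      (∀ s (x : ⋀[A]^s (Cot n A) ⊗[A] M), nabla δ M (s + 1) (nabla δ M s x) = 0) ∧
      (∀ s, n < s → Subsingleton (⋀[A]^s (Cot n A) ⊗[A] M))) ∧
    -- the sequence `0 → sol_A(M) → R → T* ⊗ R → ⋯ → ∧ⁿ T* ⊗ R → 0` of the inverse system `R`,
    -- built from the exterior derivative and the Spencer operator; the kernel of its first
    -- operator `∇` is `sol_A(M)`
    ((∀ i (f : InvSystem A M) (m : M),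
        (DiffOp.d δ i • f) m = δ.der i (f m) - f (DiffOp.d δ i • m)) ∧
      (∀ s (ω : ⋀[A]^s (Cot n A)) (f : InvSystem A M),
        nabla δ (InvSystem A M) s (ω ⊗ₜ[A] f) = extDer δ s ω ⊗ₜ[A] f +
          ∑ i, wedge s (coframe n A i) ω ⊗ₜ[A] (DiffOp.d δ i • f)) ∧
      Function.Injective (solToDeRham δ M) ∧
      Function.Exact (solToDeRham δ M) (nabla δ (InvSystem A M) 0) ∧
      (∀ s (x : ⋀[A]^s (Cot n A) ⊗[A] InvSystem A M),
        nabla δ (InvSystem A M) (s + 1) (nabla δ (InvSystem A M) s x) = 0) ∧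
      (∀ s, n < s → Subsingleton (⋀[A]^s (Cot n A) ⊗[A] InvSystem A M))) ∧
    -- the formulas for the maps of the Spencer complex `SP(M)`
    ((∀ (P : DiffOp δ) (m : M),
        spencerAug δ M (Spencer.mk δ P m (exteriorPower.ιMulti A 0 ![])) = P • m) ∧
      (∀ (P : DiffOp δ) (m : M) (ξ : Tan n A),
        spencerD δ M 0 (Spencer.mk δ P m (exteriorPower.ιMulti A 1 ![ξ])) =
          Spencer.mk δ (P * DiffOp.ofVec δ ξ) m (exteriorPower.ιMulti A 0 ![]) -
            Spencer.mk δ P (DiffOp.ofVec δ ξ • m) (exteriorPower.ιMulti A 0 ![])) ∧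
      (∀ r (P : DiffOp δ) (m : M) (ξ : Fin (r + 2) → Tan n A),
        spencerD δ M (r + 1) (Spencer.mk δ P m (exteriorPower.ιMulti A (r + 2) ξ)) =
          ∑ j : Fin (r + 2), (-1 : ℤ) ^ (j : ℕ) •
            (Spencer.mk δ (P * DiffOp.ofVec δ (ξ j)) m
                (exteriorPower.ιMulti A (r + 1) (j.removeNth ξ)) -
              Spencer.mk δ P (DiffOp.ofVec δ (ξ j) • m)
                (exteriorPower.ιMulti A (r + 1) (j.removeNth ξ))) +
          ∑ j : Fin (r + 2), ∑ i : Fin (r + 1), if i.castSucc < j then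
            (-1 : ℤ) ^ ((i : ℕ) + (j : ℕ)) •
              Spencer.mk δ P m (exteriorPower.ιMulti A (r + 1)
                (Matrix.vecCons (bracket δ (ξ i.castSucc) (ξ j)) (i.removeNth (j.removeNth ξ))))
          else 0)) ∧
    -- `SP(M)` is a resolution of `M`
    (Function.Surjective (spencerAug δ M) ∧
      Function.Exact (spencerD δ M 0) (spencerAug δ M) ∧
      (∀ r, Function.Exact (spencerD δ M (r + 1)) (spencerD δ M r)) ∧
      (∀ r, n < r → Subsingleton (Spencer δ M r))) ∧
    -- the isomorphisms of complexes
    -- `hom_D(SP(A) ⊗_A M, A) ≅ hom_D(SP(A), hom_A(M, A)) ≅ DR(R)`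
    (∃ (φ : ∀ r, (TensorA A (Spencer δ A r) M →ₗ[DiffOp δ] A) ≃+
          (Spencer δ A r →ₗ[DiffOp δ] InvSystem A M))
        (ψ : ∀ r, (Spencer δ A r →ₗ[DiffOp δ] InvSystem A M) ≃+
          ⋀[A]^r (Cot n A) ⊗[A] InvSystem A M),
      (∀ r F (x : Spencer δ A r) (m : M), φ r F x m = F (TensorA.tmul A x m)) ∧
      (∀ r (ω : ⋀[A]^r (Cot n A)) (f : InvSystem A M) (θ : ⋀[A]^r (Tan n A)),
        (ψ r).symm (ω ⊗ₜ[A] f) (Spencer.mk δ 1 1 θ) =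
          exteriorPower.pairingDual A (Tan n A) r ω θ • f) ∧
      (∀ r (F : TensorA A (Spencer δ A r) M →ₗ[DiffOp δ] A),
        φ (r + 1) (F ∘ₗ TensorA.map δ M (spencerD δ A r)) = φ r F ∘ₗ spencerD δ A r) ∧
      (∀ r (G : Spencer δ A r →ₗ[DiffOp δ] InvSystem A M),
        ψ (r + 1) (G ∘ₗ spencerD δ A r) = nabla δ (InvSystem A M) r (ψ r G))) := by
  refine ⟨⟨fun s ω m => nabla_tmul δ M s ω m, fun s x => nabla_nabla δ M s x,
      fun s hs => subsingleton_forms_tensor M hs⟩,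
    ⟨fun i f m => InvSystem.d_smul_apply δ M i f m,
      fun s ω f => nabla_tmul δ (InvSystem A M) s ω f, solToDeRham_injective δ M,
      exact_solToDeRham_nabla δ M, fun s x => nabla_nabla δ (InvSystem A M) s x,
      fun s hs => subsingleton_forms_tensor (InvSystem A M) hs⟩,
    ⟨fun P m => spencerAug_mk δ M P m ![], spencerD_mk_one δ M, spencerD_mk δ M⟩,
    ⟨spencerAug_surjective δ M, exact_spencerD_spencerAug δ M, exact_spencerD_spencerD δ M,
      fun r hr => subsingleton_spencer δ M hr⟩,
    -- Compatibility of the adjunction with the differentials is definitional: both maps send `x`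
    -- and `m` to `F (d* x ⊗ m)`.
    fun r => curryDEquiv δ (Spencer δ A r) M, fun r => spencerDeRhamEquiv δ (InvSystem A M) r,
    fun r F x m => rfl, fun r ω f θ => ?_, fun r F => rfl,
    fun r G => spencerDeRhamEquiv_comp δ (InvSystem A M) r G⟩
  rw [spencerDeRhamEquiv_symm_mk, formsHomEquiv_tmul]
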